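/- Let $\eta=\frac{1+\sqrt{-7}}2$, so that $\mathbb Z[\eta]$ is the ring of integers of $\mathbb Q(\sqrt{-7})$ (a principal ideal domain with units $\pm1$), and $N(a+b\eta)=a^2+ab+2b^2$. Let $\chi$ be the Hecke Grössencharacter given by $$\chi\big((a+b\eta)\big)=\left(\frac{a^3-2a^2b-ab^2+b^3}{7}\right)(a+b\eta),$$ where $\left(\frac{\cdot}{7}\right)$ is the Legendre symbol. For odd $k\ge1$ put, for $\operatorname{Re}s>1$, $$L(s,\chi^{k})=\frac12\sum_{\substack{(a,b)\in\mathbb Z^2\\(a,b)\neq(0,0)}}\frac{\chi\big((a+b\eta)\big)^{k}}{(a^2+ab+2b^2)^{s+k/2}} ,$$ and let $L(s,\chi^k)$ also denote the continuation of this function to all $s\in\mathbb C$. For every $n\ge1$ the series for $L(s,\chi^{4n-3})$ converges absolutely for $\operatorname{Re}s>1$ and continues to an entire function, and, as $N\to\infty$, $$\frac1N\sum_{n=1}^{N}L\big(\tfrac12,\chi^{4n-3}\big)=\frac{2\pi}{\sqrt7}+O\!\left(\frac{\log N}{\sqrt N}\right).$$ -/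

import Mathlib

open Asymptotics Filter

noncomputable section

instance fact_prime_seven : Fact (Nat.Prime 7) := ⟨by norm_num⟩

namespace HeckeSeven

/-- `η = (1 + √-7) / 2`, so that the ring of integers of `ℚ(√-7)` is `{a + b η : a, b ∈ ℤ}`. -/
def eta : ℂ := (1 + Complex.I * (√7 : ℝ)) / 2

/-- The norm `N(a + b η) = a² + a b + 2 b²`. -/
def nrm (p : ℤ × ℤ) : ℤ := p.1 ^ 2 + p.1 * p.2 + 2 * p.2 ^ 2

/-- The sign `ε_{a,b}`: the residue `±1` of `(a + b η) ^ 3` modulo `√-7`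
(and `0` when `a + b η` is not prime to `√-7`). -/
def eps (p : ℤ × ℤ) : ℤ :=
  legendreSym 7 (p.1 ^ 3 - 2 * p.1 ^ 2 * p.2 - p.1 * p.2 ^ 2 + p.2 ^ 3)

/-- The Hecke Grössencharacter at the ideal generated by `a + b η`. -/
def chi (p : ℤ × ℤ) : ℂ := (eps p : ℂ) * ((p.1 : ℂ) + (p.2 : ℂ) * eta)

/-- The summand of `L(s, χ ^ k)`, analytically normalised (central point `1 / 2`). The factor `1 / 2`
accounts for the two generators `±(a + b η)` of each ideal. -/
def term (k : ℕ) (s : ℂ) (p : ℤ × ℤ) : ℂ :=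
  (1 / 2) * (chi p ^ k / (nrm p : ℂ) ^ (s + (k : ℂ) / 2))

/-- `f` is the entire continuation of the (absolutely convergent for `Re s > 1`) series
`L(s, χ ^ k) = (1 / 2) ∑_{(a, b) ≠ (0, 0)} χ(a + b η) ^ k / N(a + b η) ^ (s + k / 2)`. -/
def IsHeckeL (k : ℕ) (f : ℂ → ℂ) : Prop :=
  Differentiable ℂ f ∧
    ∀ s : ℂ, 1 < s.re → HasSum (fun p : {p : ℤ × ℤ // p ≠ (0, 0)} => term k s p.1) (f s)

/-- There is at most one entire continuation. -/
theorem IsHeckeL.unique {k : ℕ} {f g : ℂ → ℂ} (hf : IsHeckeL k f) (hg : IsHeckeL k g) : f = g := by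
  have hfa : AnalyticOnNhd ℂ f Set.univ := fun z _ => hf.1.analyticAt z
  have hga : AnalyticOnNhd ℂ g Set.univ := fun z _ => hg.1.analyticAt z
  refine hfa.eq_of_eventuallyEq hga (z₀ := 2) ?_
  have h : {s : ℂ | 1 < s.re} ∈ nhds (2 : ℂ) :=
    (isOpen_lt continuous_const Complex.continuous_re).mem_nhds (by norm_num)
  filter_upwards [h] with s hs
  exact (hf.2 s hs).unique (hg.2 s hs)

/-- The Hecke `L`-function `s ↦ L(s, χ ^ k)`: the unique entire function that extends the series
(an unspecified function if there were none). -/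
def heckeL (k : ℕ) : ℂ → ℂ := Classical.epsilon (IsHeckeL k)

/-- The first moment `(1 / N) ∑_{n = 1}^{N} L(1 / 2, χ ^ (4 n - 3))` of the central values. -/
def firstMoment (N : ℕ) : ℂ :=
  (1 / (N : ℂ)) * ∑ n ∈ Finset.Icc 1 N, heckeL (4 * n - 3) (1 / 2)

end HeckeSeven

end

/-! Write `λ = a + b η`, `N = λ λ̄` and `k = 4 j + 1`. Poisson summation gives the theta series with
coefficients `ε λ ^ k` a functional equation of sign `+1`. Its Mellin transform continues `L(s, χ ^
k)`, and folding the Mellin integral at the centre yields an exact formula (`hasSum_central_value`):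
`L(1/2, χ ^ k)` is the sum over `λ` of `ε λ ^ (4 j + 1) / N ^ (2 j + 1)` times `Q(2 j + 1, 2 π N /
7)`. Here `Q(M, y) = Γ(M, y) / Γ(M)` is a smooth cutoff that decreases in `y` and increases in `M`.

The terms with `b = 0` contribute `∑ (a / 7) Q / a` over all integers `a`, a smoothed form of `2
L(1, (· / 7)) = 2 π / √7`. By partial summation the smoothing costs `O(1 / √(2 j + 1))`
(`real_part_bound`), hence `O(√N)` after summing over `N` values of `j`.

For `b ≠ 0` the sum over `j` is a geometric sum in `w = (λ / λ̄) ^ 2` with monotone weights, so it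
is at most `4 / |w - 1|` times the last weight. Since `|w - 1| = √7 |b| |2 a + b| / N(λ)`, a term is
`O((1 / |b| + 1 / |2 a + b|) Q)`, and `Q` confines `b` and `2 a + b` essentially to size `√N`. The
total is `O(√N log N)` (`off_diagonal_bound`). The other resonance `2 a + b = 0` is harmless because
`ε` vanishes there. Dividing by `N` gives the theorem. -/

noncomputable section

namespace HeckeSeven
open Complex Finset

/-! ### Arithmetic of `ε`, `λ` and the norm form. -/

/-- The complex number `a + b η`. -/
def lam (p : ℤ × ℤ) : ℂ := (p.1 : ℂ) + (p.2 : ℂ) * eta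

/-- Modulo `√-7` one has `η ≡ 1 / 2 ≡ 4`, and the cubic form is `(a + 4 b) ^ 3` modulo `7`. A cube
has the Legendre symbol of its root, and `2 a + b ≡ 2 (a + 4 b)` with `2` a square. Both linear
forms are needed: one on each side of the theta functional equation. -/
theorem eps_eq (p : ℤ × ℤ) : eps p = legendreSym 7 (2 * p.1 + p.2) := by
  have h : ∀ a b : ZMod 7, quadraticChar (ZMod 7) (a ^ 3 - 2 * a ^ 2 * b - a * b ^ 2 + b ^ 3) =
      quadraticChar (ZMod 7) (2 * a + b) := by decide
  have := h (p.1 : ZMod 7) (p.2 : ZMod 7)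
  unfold eps legendreSym
  push_cast
  exact this

theorem eps_eq' (p : ℤ × ℤ) : eps p = legendreSym 7 (p.1 + 4 * p.2) := by
  have h : ∀ a b : ZMod 7, quadraticChar (ZMod 7) (a ^ 3 - 2 * a ^ 2 * b - a * b ^ 2 + b ^ 3) =
      quadraticChar (ZMod 7) (a + 4 * b) := by decide
  have := h (p.1 : ZMod 7) (p.2 : ZMod 7)
  unfold eps legendreSym
  push_cast
  exact this

theorem legendreSym_seven_trichotomy (m : ℤ) :
    legendreSym 7 m = 0 ∨ legendreSym 7 m = 1 ∨ legendreSym 7 m = -1 := by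
  by_cases h : (m : ZMod 7) = 0
  · exact Or.inl ((legendreSym.eq_zero_iff 7 m).2 h)
  · exact Or.inr (legendreSym.eq_one_or_neg_one 7 h)

theorem abs_legendreSym_seven_le (m : ℤ) : |(legendreSym 7 m : ℝ)| ≤ 1 := by
  rcases legendreSym_seven_trichotomy m with h | h | h <;> simp [h]

theorem norm_legendreSym_seven_le (m : ℤ) : ‖(legendreSym 7 m : ℂ)‖ ≤ 1 := by
  rcases legendreSym_seven_trichotomy m with h | h | h <;> simp [h]

theorem norm_eps_le (p : ℤ × ℤ) : ‖(eps p : ℂ)‖ ≤ 1 := by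
  rw [eps_eq]; exact norm_legendreSym_seven_le _

theorem legendreSym_seven_neg (m : ℤ) : legendreSym 7 (-m) = - legendreSym 7 m := by
  have h : ∀ a : ZMod 7, quadraticChar (ZMod 7) (-a) = -quadraticChar (ZMod 7) a := by decide
  have := h (m : ZMod 7)
  unfold legendreSym
  push_cast
  exact this

theorem legendreSym_seven_add_mul (m q : ℤ) : legendreSym 7 (m + 7 * q) = legendreSym 7 m := by
  unfold legendreSym
  push_cast
  have : (7 : ZMod 7) = 0 := by decide
  rw [this]; simp

theorem legendreSym_seven_values :
    legendreSym 7 0 = 0 ∧ legendreSym 7 1 = 1 ∧ legendreSym 7 2 = 1 ∧ legendreSym 7 3 = -1 ∧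
    legendreSym 7 4 = 1 ∧ legendreSym 7 5 = -1 ∧ legendreSym 7 6 = -1 := by
  unfold legendreSym; decide

theorem lam_re (p : ℤ × ℤ) : (lam p).re = (2 * p.1 + p.2) / 2 := by
  simp [lam, eta]; ring

theorem lam_im (p : ℤ × ℤ) : (lam p).im = √7 * p.2 / 2 := by
  simp [lam, eta]; ring

theorem norm_lam_sq (p : ℤ × ℤ) : ‖lam p‖ ^ 2 = (nrm p : ℝ) := by
  rw [← Complex.normSq_eq_norm_sq, Complex.normSq_apply, lam_re, lam_im]
  have : √7 * √7 = (7 : ℝ) := Real.mul_self_sqrt (by norm_num)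
  simp only [nrm]; push_cast
  linear_combination ((p.2 : ℝ) ^ 2 / 4) * this

theorem nrm_ge (p : ℤ × ℤ) : ((p.1 : ℝ) ^ 2 + (p.2 : ℝ) ^ 2) / 2 ≤ (nrm p : ℝ) := by
  simp only [nrm]; push_cast
  nlinarith [sq_nonneg ((p.1 : ℝ) + p.2), sq_nonneg (p.2 : ℝ)]

theorem nrm_pos {p : ℤ × ℤ} (hp : p ≠ (0, 0)) : 0 < nrm p := by
  have h : p.1 ≠ 0 ∨ p.2 ≠ 0 := by
    by_contra! h; exact hp (Prod.ext h.1 h.2)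
  simp only [nrm]
  rcases h with h | h
  · nlinarith [sq_nonneg (p.1 + p.2), sq_nonneg p.2, sq_pos_of_ne_zero h]
  · nlinarith [sq_nonneg (p.1 + p.2), sq_nonneg (2 * p.1 + p.2), sq_pos_of_ne_zero h]

theorem nrm_nonneg (p : ℤ × ℤ) : 0 ≤ nrm p := by
  simp only [nrm]
  nlinarith [sq_nonneg (p.1 + p.2), sq_nonneg (2 * p.1 + p.2), sq_nonneg p.2]

theorem eps_zero : eps (0, 0) = 0 := by simp [eps]

/-! ### The quadratic Gauss sum modulo `7`. -/

/-- The primitive seventh root of unity. -/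
def zeta : ℂ := cexp (2 * Real.pi * I / 7)

theorem zeta_pow_seven : zeta ^ 7 = 1 := by
  rw [zeta, ← Complex.exp_nat_mul]
  convert Complex.exp_two_pi_mul_I using 2
  push_cast; ring

theorem zeta_geom : 1 + zeta + zeta ^ 2 + zeta ^ 3 + zeta ^ 4 + zeta ^ 5 + zeta ^ 6 = 0 := by
  have h : zeta ≠ 1 := by
    have := (Complex.isPrimitiveRoot_exp 7 (by norm_num)).ne_one (by norm_num)
    simpa [zeta] using this
  have h2 : (zeta - 1) * (1 + zeta + zeta ^ 2 + zeta ^ 3 + zeta ^ 4 + zeta ^ 5 + zeta ^ 6) = 0 := by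
    linear_combination zeta_pow_seven
  exact (mul_eq_zero.1 h2).resolve_left (sub_ne_zero.2 h)

theorem zeta_pow_im (n : ℕ) : (zeta ^ n).im = Real.sin (n * (2 * Real.pi / 7)) := by
  rw [zeta, ← Complex.exp_nat_mul]
  have : (n : ℂ) * (2 * Real.pi * I / 7) = ((n * (2 * Real.pi / 7) : ℝ) : ℂ) * I := by
    push_cast; ring
  rw [this, Complex.exp_ofReal_mul_I_im]

/-- The square is computed from `1 + ζ + ... + ζ ^ 6 = 0`. The sign is then fixed by the imaginary
part, which is `2 (sin (2π/7) + sin (4π/7) - sin (π/7)) > 0`. -/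
theorem gauss_seven :
    zeta + zeta ^ 2 - zeta ^ 3 + zeta ^ 4 - zeta ^ 5 - zeta ^ 6 = I * (√7 : ℝ) := by
  set S := zeta + zeta ^ 2 - zeta ^ 3 + zeta ^ 4 - zeta ^ 5 - zeta ^ 6 with hS
  have h7 : ((√7 : ℝ) : ℂ) ^ 2 = 7 := by
    rw [← Complex.ofReal_pow, Real.sq_sqrt (by norm_num)]; norm_num
  have hsq : S ^ 2 = -7 := by
    have e8 : zeta ^ 8 = zeta := by linear_combination zeta * zeta_pow_seven
    have e10 : zeta ^ 10 = zeta ^ 3 := by linear_combination zeta ^ 3 * zeta_pow_seven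
    have e11 : zeta ^ 11 = zeta ^ 4 := by linear_combination zeta ^ 4 * zeta_pow_seven
    have e12 : zeta ^ 12 = zeta ^ 5 := by linear_combination zeta ^ 5 * zeta_pow_seven
    rw [hS]
    ring_nf
    rw [e8, e10, e11, e12, zeta_pow_seven]
    linear_combination zeta_geom
  have hfac : (S - I * (√7 : ℝ)) * (S + I * (√7 : ℝ)) = 0 := by
    linear_combination hsq + h7 - ((√7 : ℝ) : ℂ) ^ 2 * I_sq
  rcases mul_eq_zero.1 hfac with h | h
  · exact sub_eq_zero.1 h
  · exfalso
    have him : S.im = -√7 := by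
      rw [eq_neg_of_add_eq_zero_left h]; simp
    have hz1 := zeta_pow_im 1
    rw [pow_one] at hz1
    have him2 : S.im = Real.sin (2 * Real.pi / 7) + Real.sin (2 * (2 * Real.pi / 7))
        - Real.sin (3 * (2 * Real.pi / 7)) + Real.sin (4 * (2 * Real.pi / 7))
        - Real.sin (5 * (2 * Real.pi / 7)) - Real.sin (6 * (2 * Real.pi / 7)) := by
      rw [hS]
      simp only [sub_im, add_im, zeta_pow_im, hz1]
      push_cast; ring_nf
    have s4 : Real.sin (4 * (2 * Real.pi / 7)) = - Real.sin (Real.pi / 7) := by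
      rw [← Real.sin_add_pi]; congr 1; ring
    have s3 : Real.sin (3 * (2 * Real.pi / 7)) = Real.sin (Real.pi / 7) := by
      rw [← Real.sin_pi_sub]; congr 1; ring
    have s5 : Real.sin (5 * (2 * Real.pi / 7)) = - Real.sin (2 * (2 * Real.pi / 7)) := by
      rw [← Real.sin_neg, ← Real.sin_sub_two_pi]; congr 1; ring
    have s6 : Real.sin (6 * (2 * Real.pi / 7)) = - Real.sin (2 * Real.pi / 7) := by
      rw [← Real.sin_neg, ← Real.sin_sub_two_pi]; congr 1; ring
    have hpi := Real.pi_pos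
    have p1 : Real.sin (Real.pi / 7) < Real.sin (2 * Real.pi / 7) :=
      Real.sin_lt_sin_of_lt_of_le_pi_div_two (by linarith) (by linarith) (by linarith)
    have p2 : 0 < Real.sin (2 * (2 * Real.pi / 7)) :=
      Real.sin_pos_of_pos_of_lt_pi (by linarith) (by linarith)
    have : (0 : ℝ) < √7 := by positivity
    linarith

theorem exp_eq_zeta_pow (j : ℕ) (m : ℤ) :
    cexp (2 * Real.pi * I * (j * m / 7)) = (zeta ^ m) ^ j := by
  rw [zeta, ← Complex.exp_int_mul, ← Complex.exp_nat_mul]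
  congr 1; ring

/-- The finite Fourier expansion of the Legendre symbol modulo `7`. -/
theorem legendreSym_fourier (m : ℤ) :
    ∑ j ∈ range 7, (legendreSym 7 (j : ℤ) : ℂ) * cexp (2 * Real.pi * I * (j * m / 7)) =
      (I * (√7 : ℝ)) * legendreSym 7 m := by
  obtain ⟨v0, v1, v2, v3, v4, v5, v6⟩ := legendreSym_seven_values
  have hz0 : zeta ≠ 0 := Complex.exp_ne_zero _
  simp_rw [exp_eq_zeta_pow]
  obtain ⟨r, q, hr, hm⟩ : ∃ r : ℕ, ∃ q : ℤ, r < 7 ∧ m = r + 7 * q :=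
    ⟨(m % 7).toNat, m / 7, by omega, by omega⟩
  have hz : zeta ^ m = zeta ^ r := by
    rw [hm, zpow_add₀ hz0, zpow_mul]
    norm_cast
    rw [zeta_pow_seven]; simp
  rw [hz, hm, legendreSym_seven_add_mul]
  have red : ∀ n : ℕ, zeta ^ n = zeta ^ (n % 7) := by
    intro n
    conv_lhs => rw [← Nat.mod_add_div n 7, pow_add, pow_mul, zeta_pow_seven, one_pow, mul_one]
  rw [← gauss_seven]
  simp only [sum_range_succ, sum_range_zero, ← pow_mul]
  interval_cases r <;> simp only [red (_ * _)] <;> norm_num [v0, v1, v2, v3, v4, v5, v6] <;> ring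

/-! ### The two-variable theta series and its functional equation. -/

theorem summable_exp_neg_mul_sq {c : ℝ} (hc : 0 < c) :
    Summable fun n : ℤ => Real.exp (-c * (n : ℝ) ^ 2) := by
  have h : Summable fun n : ℕ => Real.exp (-c * (n : ℝ) ^ 2) := by
    refine Summable.of_nonneg_of_le (fun _ => (Real.exp_pos _).le) (fun n => ?_)
      (Real.summable_exp_nat_mul_iff.2 (neg_lt_zero.2 hc))
    apply Real.exp_le_exp.2
    have : (n : ℝ) ≤ (n : ℝ) ^ 2 := by exact_mod_cast Nat.le_self_pow (by norm_num) n
    nlinarith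
  refine Summable.of_nat_of_neg (by simpa using h) (by simpa using h)

theorem summable_cexp_quadratic {t : ℝ} (ht : 0 < t) (b : ℂ) :
    Summable fun n : ℤ => cexp (-Real.pi * t * (n : ℂ) ^ 2 + 2 * Real.pi * b * n) := by
  have h := (summable_jacobiTheta₂_term_iff (-I * b) (I * t)).2 (by simpa using ht)
  refine h.congr fun n => ?_
  rw [jacobiTheta₂_term]
  congr 1
  linear_combination (-(2 * Real.pi * n * b) + Real.pi * n ^ 2 * t) * I_sq

theorem summable_exp_neg_mul_nrm {c : ℝ} (hc : 0 < c) :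
    Summable fun p : ℤ × ℤ => Real.exp (-c * (nrm p : ℝ)) := by
  have h := summable_exp_neg_mul_sq (half_pos hc)
  have h2 := h.mul_of_nonneg h (fun _ => (Real.exp_pos _).le) (fun _ => (Real.exp_pos _).le)
  refine Summable.of_nonneg_of_le (fun _ => (Real.exp_pos _).le) (fun p => ?_) h2
  rw [← Real.exp_add]
  apply Real.exp_le_exp.2
  nlinarith [nrm_ge p]

/-- Completing the square: half of the Gaussian absorbs the linear exponential. -/
theorem exp_norm_lam_le {t : ℝ} (ht : 0 < t) (v : ℝ) (p : ℤ × ℤ) :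
    Real.exp (-(Real.pi * t * nrm p) + v * ‖lam p‖) ≤
      Real.exp (v ^ 2 / (2 * Real.pi * t)) * Real.exp (-(Real.pi * t / 2) * nrm p) := by
  rw [← Real.exp_add]
  apply Real.exp_le_exp.2
  have hpt : 0 < Real.pi * t := mul_pos Real.pi_pos ht
  rw [← norm_lam_sq]
  have : v ^ 2 / (2 * Real.pi * t) - v * ‖lam p‖ + (Real.pi * t / 2) * ‖lam p‖ ^ 2
      = (v - Real.pi * t * ‖lam p‖) ^ 2 / (2 * Real.pi * t) := by
    have := Real.pi_pos
    field_simp; ring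
  have h2 : 0 ≤ (v - Real.pi * t * ‖lam p‖) ^ 2 / (2 * Real.pi * t) := by
    apply div_nonneg (sq_nonneg _); linarith
  linarith

theorem summable_exp_norm_lam {t : ℝ} (ht : 0 < t) (v : ℝ) :
    Summable fun p : ℤ × ℤ => Real.exp (-(Real.pi * t * nrm p) + v * ‖lam p‖) :=
  Summable.of_nonneg_of_le (fun _ => (Real.exp_pos _).le) (exp_norm_lam_le ht v)
    ((summable_exp_neg_mul_nrm (by have := Real.pi_pos; positivity)).mul_left _)

/-- The summand of the two-variable theta series. -/
def thetaTerm (t : ℝ) (u : ℂ) (p : ℤ × ℤ) : ℂ :=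
  (eps p : ℂ) * cexp (-(Real.pi * t * nrm p) + u * lam p)

/-- The theta series generating all the theta series with coefficients `ε λ ^ k`. -/
def theta (t : ℝ) (u : ℂ) : ℂ := ∑' p, thetaTerm t u p

theorem summable_thetaTerm {t : ℝ} (ht : 0 < t) (u : ℂ) : Summable (thetaTerm t u) := by
  refine Summable.of_norm_bounded (summable_exp_norm_lam ht ‖u‖) fun p => ?_
  rw [thetaTerm, norm_mul, Complex.norm_exp]
  refine (mul_le_of_le_one_left (Real.exp_pos _).le (norm_eps_le p)).trans ?_
  apply Real.exp_le_exp.2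
  have h1 : (-(Real.pi * t * nrm p) + u * lam p : ℂ).re = -(Real.pi * t * nrm p) + (u * lam p).re := by
    rw [add_re, neg_re]
    congr 2
    rw [show (Real.pi * t * nrm p : ℂ) = ((Real.pi * t * nrm p : ℝ) : ℂ) by push_cast; rfl, ofReal_re]
  rw [h1]
  have := (Complex.re_le_norm (u * lam p)).trans_eq (norm_mul _ _)
  linarith

theorem tsum_int_eq_sum_range {F : ℤ → ℂ} (hF : Summable F) :
    ∑' m, F m = ∑ j ∈ range 7, ∑' n : ℤ, F (7 * n - j) := by
  have inj : Function.Injective fun q : Fin 7 × ℤ => 7 * q.2 - ((q.1 : ℕ) : ℤ) := by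
    rintro ⟨j, n⟩ ⟨j', n'⟩ h
    have := j.2; have := j'.2
    simp only at h
    refine Prod.ext (Fin.ext ?_) ?_ <;> simp <;> omega
  have surj : Function.Surjective fun q : Fin 7 × ℤ => 7 * q.2 - ((q.1 : ℕ) : ℤ) := fun m =>
    ⟨(⟨((-m) % 7).toNat, by omega⟩, -((-m) / 7)), by simp only; omega⟩
  have h1 : ∑' q : Fin 7 × ℤ, F (7 * q.2 - ((q.1 : ℕ) : ℤ)) = ∑' m, F m :=
    (Equiv.ofBijective _ ⟨inj, surj⟩).tsum_eq F
  have h2 : Summable fun q : Fin 7 × ℤ => F (7 * q.2 - ((q.1 : ℕ) : ℤ)) := hF.comp_injective inj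
  rw [← h1, h2.tsum_prod, tsum_fintype, Finset.sum_range]

/-- Poisson summation for Gaussians twisted by the Legendre symbol modulo `7`. -/
theorem twisted_poisson {t : ℝ} (ht : 0 < t) (w : ℂ) :
    ∑' a : ℤ, (legendreSym 7 a : ℂ) * cexp (-Real.pi * t * (a : ℂ) ^ 2 + 2 * Real.pi * w * a) =
      (I / (√7 : ℝ)) * (1 / (t : ℂ) ^ (1 / 2 : ℂ)) *
        ∑' m : ℤ, (legendreSym 7 m : ℂ) * cexp (-Real.pi / t * ((m : ℂ) / 7 + I * w) ^ 2) := by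
  have h7 : ((√7 : ℝ) : ℂ) ≠ 0 := by
    rw [Ne, ofReal_eq_zero]; positivity
  have ht0 : (t : ℂ) ≠ 0 := by exact_mod_cast ht.ne'
  have hI := I_ne_zero
  have e1 : ∀ a : ℤ, (legendreSym 7 a : ℂ) * cexp (-Real.pi * t * (a : ℂ) ^ 2 + 2 * Real.pi * w * a) =
      ∑ j ∈ range 7, (legendreSym 7 (j : ℤ) : ℂ) / (I * (√7 : ℝ)) *
        cexp (-Real.pi * t * (a : ℂ) ^ 2 + 2 * Real.pi * (w + I * j / 7) * a) := by
    intro a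
    have h := legendreSym_fourier a
    have h' : (legendreSym 7 a : ℂ) = (∑ j ∈ range 7, (legendreSym 7 (j : ℤ) : ℂ) *
        cexp (2 * Real.pi * I * (j * a / 7))) / (I * (√7 : ℝ)) := by
      rw [h]; field_simp
    rw [h', Finset.sum_div, Finset.sum_mul]
    refine Finset.sum_congr rfl fun j _ => ?_
    rw [mul_div_right_comm, mul_assoc, ← Complex.exp_add]
    congr 2; ring
  simp_rw [e1]
  rw [Summable.tsum_finsetSum fun j _ => (summable_cexp_quadratic ht _).mul_left _]
  have hs : Summable fun m : ℤ => (legendreSym 7 m : ℂ) *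
      cexp (-Real.pi / t * ((m : ℂ) / 7 + I * w) ^ 2) := by
    have h := (summable_cexp_quadratic (t := 1 / (49 * t)) (by positivity) (-(I * w / (7 * t)))).mul_left
      (cexp (-Real.pi / t * (I * w) ^ 2))
    refine Summable.of_norm_bounded h.norm fun m => ?_
    rw [norm_mul]
    refine (mul_le_of_le_one_left (norm_nonneg _) (norm_legendreSym_seven_le m)).trans (le_of_eq ?_)
    rw [← Complex.exp_add]
    congr 2
    push_cast
    field_simp; ring
  rw [tsum_int_eq_sum_range hs, Finset.mul_sum]
  refine Finset.sum_congr rfl fun j _ => ?_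
  rw [tsum_mul_left, Complex.tsum_exp_neg_quadratic (by simpa using ht)]
  -- The shift by `I j / 7` turns the dual variable `n` into `(7 n - j) / 7`. The symbol is odd, and
  -- the resulting sign turns `1 / (I √7)` into `I / √7`.
  have e2 : ∀ n : ℤ, (legendreSym 7 (7 * n - j) : ℂ) *
      cexp (-Real.pi / t * (((7 * n - j : ℤ) : ℂ) / 7 + I * w) ^ 2) =
      -(legendreSym 7 (j : ℤ) : ℂ) * cexp (-Real.pi / t * (n + I * (w + I * j / 7)) ^ 2) := by
    intro n
    rw [show (7 * n - j : ℤ) = -j + 7 * n by ring, legendreSym_seven_add_mul, legendreSym_seven_neg]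
    push_cast
    congr 4
    linear_combination (-(j : ℂ) / 7) * I_sq
  simp_rw [e2]
  rw [tsum_mul_left]
  generalize ∑' n : ℤ, cexp (-Real.pi / t * (n + I * (w + I * j / 7)) ^ 2) = T
  have hI2 : I / (√7 : ℝ) = -(1 / (I * (√7 : ℝ))) := by
    field_simp; exact I_sq
  rw [hI2]
  ring

-- Two one-dimensional Poisson summations. In the coordinates `(b, a + 4 b)` the sign depends on the
-- second one alone, so the twisted formula applies to it. The remaining sum over `b` is an
-- untwisted Gaussian of parameter `7 t / 4`.
set_option maxHeartbeats 1000000 in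
theorem theta_functional_equation {t : ℝ} (ht : 0 < t) (u : ℂ) :
    theta t u = (2 * I / (7 * t)) * theta (4 / (49 * t)) (-2 * I * u / (7 * t)) := by
  have ht0 : (t : ℂ) ≠ 0 := by exact_mod_cast ht.ne'
  have hpi0 : (Real.pi : ℂ) ≠ 0 := by exact_mod_cast Real.pi_ne_zero
  have h7 : ((√7 : ℝ) : ℂ) ≠ 0 := by
    rw [Ne, ofReal_eq_zero]; positivity
  have h7s : ((√7 : ℝ) : ℂ) ^ 2 = 7 := by
    rw [← Complex.ofReal_pow, Real.sq_sqrt (by norm_num)]; norm_num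
  -- shear to the coordinates `(b, a + 4 b)`
  let e : ℤ × ℤ ≃ ℤ × ℤ :=
    ⟨fun q => (q.2 - 4 * q.1, q.1), fun p => (p.2, p.1 + 4 * p.2),
      fun q => by simp, fun p => by simp⟩
  let Q : ℤ → ℂ := fun b => cexp (-(14 * Real.pi * t * b ^ 2) + u * (-7 / 2 + I * (√7 : ℝ) / 2) * b)
  have hterm : ∀ b a : ℤ, thetaTerm t u (e (b, a)) = Q b * ((legendreSym 7 a : ℂ) *
      cexp (-Real.pi * t * (a : ℂ) ^ 2 + 2 * Real.pi * (7 * t * b / 2 + u / (2 * Real.pi)) * a)) := by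
    intro b a
    rw [thetaTerm, eps_eq', mul_left_comm, ← Complex.exp_add]
    congr 2
    · simp [e]
    · simp only [e, nrm, lam, eta, Equiv.coe_fn_mk]
      push_cast
      field_simp; ring
  have hs1 : Summable fun q : ℤ × ℤ => thetaTerm t u (e q) := e.summable_iff.2 (summable_thetaTerm ht u)
  -- the exponentials in the intermediate double sum
  let A : ℤ → ℂ := fun m => (legendreSym 7 m : ℂ) *
    cexp (-Real.pi / t * ((m : ℂ) / 7 + I * u / (2 * Real.pi)) ^ 2)
  let B : ℤ → ℤ → ℂ := fun m b =>
    cexp (-Real.pi * (7 * t / 4 : ℝ) * (b : ℂ) ^ 2 +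
      2 * Real.pi * (I * (√7 : ℝ) * u / (4 * Real.pi) - I * m / 2) * b)
  have hAB : ∀ b m : ℤ, Q b * ((legendreSym 7 m : ℂ) * cexp (-Real.pi / t *
      ((m : ℂ) / 7 + I * (7 * t * b / 2 + u / (2 * Real.pi))) ^ 2)) = A m * B m b := by
    intro b m
    simp only [A, B, Q]
    rw [mul_left_comm, ← Complex.exp_add, mul_assoc (legendreSym 7 m : ℂ), ← Complex.exp_add]
    congr 2
    push_cast
    field_simp
    ring_nf
    simp only [I_sq]
    ring
  have hA : Summable fun m => ‖A m‖ := by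
    have h := (summable_cexp_quadratic (t := 1 / (49 * t)) (by positivity)
      (-(I * u / (14 * Real.pi * t)))).mul_left (cexp (-Real.pi / t * (I * u / (2 * Real.pi)) ^ 2))
    refine Summable.of_nonneg_of_le (fun _ => norm_nonneg _) (fun m => ?_) h.norm
    simp only [A]
    rw [norm_mul]
    refine (mul_le_of_le_one_left (norm_nonneg _) (norm_legendreSym_seven_le m)).trans (le_of_eq ?_)
    rw [← Complex.exp_add]
    congr 2
    push_cast
    field_simp; ring
  have hB0 : Summable fun b => ‖B 0 b‖ := (summable_cexp_quadratic (by positivity) _).norm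
  -- `m` enters only through a unimodular phase, so the double sum is dominated by a product and may
  -- be interchanged.
  have hB : ∀ m b, ‖B m b‖ = ‖B 0 b‖ := by
    intro m b
    simp only [B]
    rw [Complex.norm_exp, Complex.norm_exp]
    congr 1
    simp only [add_re, mul_re, sub_re, I_re, I_im, div_re]
    simp
  have hs2 : Summable fun q : ℤ × ℤ => A q.1 * B q.1 q.2 := by
    refine Summable.of_norm_bounded
      (hA.mul_of_nonneg hB0 (fun _ => norm_nonneg _) (fun _ => norm_nonneg _)) fun q => ?_
    rw [norm_mul, hB]
  -- Dual coordinates with `m = 2 a + b`, so that `eps_eq` recognises the symbol of `m` as `ε`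
  -- again.
  let e' : ℤ × ℤ ≃ ℤ × ℤ :=
    ⟨fun q => (-q.2, 2 * q.2 + q.1), fun p => (2 * p.1 + p.2, -p.1),
      fun q => by simp, fun p => by simp⟩
  have hterm' : ∀ m n : ℤ, thetaTerm (4 / (49 * t)) (-2 * I * u / (7 * t)) (e' (m, n)) =
      A m * cexp (-Real.pi / (7 * t / 4 : ℝ) *
        (n + I * (I * (√7 : ℝ) * u / (4 * Real.pi) - I * m / 2)) ^ 2) := by
    intro m n
    simp only [A]
    rw [thetaTerm, eps_eq, mul_assoc (legendreSym 7 m : ℂ), ← Complex.exp_add]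
    congr 2
    · simp [e']
    · simp only [e', nrm, lam, eta, Equiv.coe_fn_mk]
      push_cast
      field_simp
      ring_nf
      simp only [I_sq, h7s, show I ^ 4 = 1 by rw [show 4 = 2 * 2 by rfl, pow_mul, I_sq]; norm_num]
      ring
  have hs3 : Summable fun q : ℤ × ℤ =>
      thetaTerm (4 / (49 * t)) (-2 * I * u / (7 * t)) (e' q) :=
    e'.summable_iff.2 (summable_thetaTerm (by positivity) _)
  have hK : (I / (√7 : ℝ)) * (1 / (t : ℂ) ^ (1 / 2 : ℂ)) * (1 / ((7 * t / 4 : ℝ) : ℂ) ^ (1 / 2 : ℂ)) =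
      2 * I / (7 * t) := by
    have hs : ∀ x : ℝ, 0 < x → (x : ℂ) ^ (1 / 2 : ℂ) = ((√x : ℝ) : ℂ) := by
      intro x hx
      rw [Real.sqrt_eq_rpow, Complex.ofReal_cpow hx.le]; norm_num
    rw [hs t ht, hs _ (by positivity)]
    have h1 : √(7 * t / 4) = √7 * √t / 2 := by
      rw [Real.sqrt_div (by positivity), Real.sqrt_mul (by norm_num),
        show (4 : ℝ) = 2 ^ 2 by norm_num, Real.sqrt_sq (by norm_num)]
    have h2 : ((√t : ℝ) : ℂ) ^ 2 = t := by
      rw [← Complex.ofReal_pow, Real.sq_sqrt ht.le]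
    have h3 : ((√t : ℝ) : ℂ) ≠ 0 := by
      rw [Ne, ofReal_eq_zero]; positivity
    rw [h1]
    push_cast
    field_simp
    rw [h2, h7s]
  calc theta t u = ∑' q : ℤ × ℤ, thetaTerm t u (e q) := (e.tsum_eq _).symm
    _ = ∑' b : ℤ, ∑' a : ℤ, thetaTerm t u (e (b, a)) := hs1.tsum_prod
    _ = ∑' b : ℤ, (I / (√7 : ℝ)) * (1 / (t : ℂ) ^ (1 / 2 : ℂ)) * ∑' m : ℤ, A m * B m b := by
        refine tsum_congr fun b => ?_
        rw [tsum_congr (hterm b), tsum_mul_left, twisted_poisson ht, mul_left_comm, ← tsum_mul_left,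
          tsum_congr (hAB b)]
    _ = (I / (√7 : ℝ)) * (1 / (t : ℂ) ^ (1 / 2 : ℂ)) * ∑' m : ℤ, ∑' b : ℤ, A m * B m b := by
        rw [tsum_mul_left, Summable.tsum_comm (f := fun m b => A m * B m b) hs2]
    _ = (I / (√7 : ℝ)) * (1 / (t : ℂ) ^ (1 / 2 : ℂ)) * ∑' m : ℤ,
          (1 / ((7 * t / 4 : ℝ) : ℂ) ^ (1 / 2 : ℂ)) *
          ∑' n : ℤ, thetaTerm (4 / (49 * t)) (-2 * I * u / (7 * t)) (e' (m, n)) := by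
        congr 1
        refine tsum_congr fun m => ?_
        rw [tsum_congr (hterm' m), tsum_mul_left, tsum_mul_left, mul_left_comm]
        congr 1
        exact Complex.tsum_exp_neg_quadratic (by rw [ofReal_re]; positivity) _
    _ = (2 * I / (7 * t)) * theta (4 / (49 * t)) (-2 * I * u / (7 * t)) := by
        rw [tsum_mul_left, ← mul_assoc, hK, ← hs3.tsum_prod, theta, e'.tsum_eq]

/-! ### Theta series with coefficients `ε λ ^ k` and their Mellin transforms. -/

/-- The theta series with coefficients `ε λ ^ k`. -/
def thetaPow (k : ℕ) (t : ℝ) : ℂ :=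
  ∑' p : ℤ × ℤ, (eps p : ℂ) * lam p ^ k * Real.exp (-(Real.pi * t * nrm p))

theorem hasSum_theta {t : ℝ} (ht : 0 < t) (u : ℂ) :
    HasSum (fun k : ℕ => u ^ k * (thetaPow k t / (k.factorial : ℂ))) (theta t u) := by
  let F : (ℤ × ℤ) × ℕ → ℂ := fun q => (eps q.1 : ℂ) * Real.exp (-(Real.pi * t * nrm q.1)) *
    ((u * lam q.1) ^ q.2 / (q.2.factorial : ℂ))
  have hexp : ∀ p, HasSum (fun k => F (p, k)) (thetaTerm t u p) := by
    intro p
    have h := (NormedSpace.expSeries_div_hasSum_exp (u * lam p)).mul_left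
      ((eps p : ℂ) * Real.exp (-(Real.pi * t * nrm p)))
    rw [← Complex.exp_eq_exp_ℂ] at h
    have e : thetaTerm t u p =
        (eps p : ℂ) * Real.exp (-(Real.pi * t * nrm p)) * cexp (u * lam p) := by
      rw [thetaTerm, mul_assoc (eps p : ℂ), Complex.ofReal_exp, ← Complex.exp_add]
      push_cast; rfl
    rw [e]
    exact h
  let G : (ℤ × ℤ) × ℕ → ℝ := fun q => Real.exp (-(Real.pi * t * nrm q.1)) *
    ((‖u‖ * ‖lam q.1‖) ^ q.2 / (q.2.factorial : ℝ))
  have hexpG : ∀ p, HasSum (fun k => G (p, k))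
      (Real.exp (-(Real.pi * t * nrm p) + ‖u‖ * ‖lam p‖)) := by
    intro p
    have h := (NormedSpace.expSeries_div_hasSum_exp (‖u‖ * ‖lam p‖)).mul_left
      (Real.exp (-(Real.pi * t * nrm p)))
    rw [← Real.exp_eq_exp_ℝ, ← Real.exp_add] at h
    exact h
  have hG : Summable G := by
    refine (summable_prod_of_nonneg (fun q => by simp only [G, Pi.zero_apply]; positivity)).2
      ⟨fun p => (hexpG p).summable, ?_⟩
    exact (summable_exp_norm_lam ht ‖u‖).congr fun p => ((hexpG p).tsum_eq).symm
  have hF : Summable F := by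
    refine Summable.of_norm_bounded hG fun q => ?_
    simp only [F, G]
    rw [norm_mul, norm_mul, norm_div, norm_pow, norm_mul, Complex.norm_natCast, Complex.norm_real,
      Real.norm_of_nonneg (Real.exp_pos _).le]
    gcongr
    exact mul_le_of_le_one_left (Real.exp_pos _).le (norm_eps_le _)
  have h1 : ∑' q, F q = theta t u := by
    rw [hF.tsum_prod]
    exact tsum_congr fun p => (hexp p).tsum_eq
  have h2 := (hF.prod_symm.hasSum).prod_fiberwise fun k => (hF.prod_symm.prod_factor k).hasSum
  have h3 : ∑' q, F (Prod.swap q) = theta t u := by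
    rw [← h1]; exact (Equiv.prodComm ℕ (ℤ × ℤ)).tsum_eq F
  rw [h3] at h2
  convert h2 using 2 with k
  rw [thetaPow, div_eq_mul_inv, ← tsum_mul_right, ← tsum_mul_left]
  refine tsum_congr fun p => ?_
  simp only [F, Prod.swap]
  rw [mul_pow]; ring

theorem coeff_unique {a b : ℕ → ℂ} {f : ℂ → ℂ} (ha : ∀ u, HasSum (fun k => u ^ k * a k) (f u))
    (hb : ∀ u, HasSum (fun k => u ^ k * b k) (f u)) : a = b := by
  have key : ∀ c : ℕ → ℂ, (∀ u, HasSum (fun k => u ^ k * c k) (f u)) →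
      HasFPowerSeriesAt f (FormalMultilinearSeries.ofScalars ℂ c) 0 := by
    intro c hc
    rw [hasFPowerSeriesAt_iff]
    refine Eventually.of_forall fun z => ?_
    simpa [FormalMultilinearSeries.coeff_ofScalars] using hc z
  have h := (key a ha).eq_formalMultilinearSeries (key b hb)
  funext k
  have := congrArg (fun q => FormalMultilinearSeries.coeff q k) h
  simpa [FormalMultilinearSeries.coeff_ofScalars] using this

/-- Both sides of the identity for `theta` are entire in `u`; comparing the coefficients of `u ^ k`
treats all `k` at once, without Poisson summation for polynomial times Gaussian. -/
theorem thetaPow_functional_equation {t : ℝ} (ht : 0 < t) (k : ℕ) :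
    thetaPow k t = (2 * I / (7 * t)) * (-2 * I / (7 * t)) ^ k * thetaPow k (4 / (49 * t)) := by
  have h := coeff_unique (a := fun k => thetaPow k t / (k.factorial : ℂ))
    (b := fun k => (2 * I / (7 * t)) * (-2 * I / (7 * t)) ^ k * thetaPow k (4 / (49 * t)) /
      (k.factorial : ℂ)) (f := theta t) (hasSum_theta ht) (fun u => by
      rw [theta_functional_equation ht u]
      refine ((hasSum_theta (t := 4 / (49 * t)) (by positivity) (-2 * I * u / (7 * t))).mul_left
        (2 * I / (7 * t))).congr_fun fun k => ?_
      rw [show -2 * I * u / (7 * t) = (-2 * I / (7 * t)) * u by ring, mul_pow]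
      ring)
  have := congrFun h k
  have hk : (k.factorial : ℂ) ≠ 0 := by exact_mod_cast k.factorial_ne_zero
  simpa [div_left_inj' hk] using this

/-- The theta series whose Mellin transform is the completed `L`-function. -/
def heckeTheta (k : ℕ) (x : ℝ) : ℂ := thetaPow k (2 * x / 7)

/-- The scaling by `2 / 7` turns `t ↔ 4 / (49 t)` into `x ↔ 1 / x`. The constant is `i (-i) ^ k`,
equal to `1` for `k ≡ 1` modulo `4`: root number `+1`. -/
theorem heckeTheta_one_div (j : ℕ) {x : ℝ} (hx : 0 < x) :
    heckeTheta (4 * j + 1) (1 / x) = (x : ℂ) ^ (4 * j + 2) * heckeTheta (4 * j + 1) x := by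
  have hx0 : (x : ℂ) ≠ 0 := by exact_mod_cast hx.ne'
  rw [heckeTheta, thetaPow_functional_equation (by positivity), heckeTheta]
  have h1 : 4 / (49 * (2 * (1 / x) / 7)) = 2 * x / 7 := by field_simp; ring
  rw [h1]
  congr 1
  push_cast
  have h2 : 2 * I / (7 * (2 * (1 / x) / 7)) = I * x := by field_simp
  have h3 : -2 * I / (7 * (2 * (1 / x) / 7)) = -(I * x) := by field_simp
  rw [h2, h3, neg_pow, mul_pow, pow_succ, pow_mul, pow_succ I, pow_mul I, I_pow_four]
  have : (-1 : ℂ) ^ 4 = 1 := by norm_num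
  rw [this]
  simp only [one_pow, one_mul]
  linear_combination (-(x : ℂ) ^ (4 * j + 2)) * I_sq

/-- From `y ^ k ≤ k! exp y`; powers of `λ` are thus covered by the summability already known for
linear exponentials. -/
theorem norm_thetaPow_term_le (k : ℕ) (t : ℝ) (p : ℤ × ℤ) :
    ‖(eps p : ℂ) * lam p ^ k * Real.exp (-(Real.pi * t * nrm p))‖ ≤
      (k.factorial : ℝ) * Real.exp (-(Real.pi * t * nrm p) + 1 * ‖lam p‖) := by
  rw [norm_mul, norm_mul, norm_pow, Complex.norm_real, Real.norm_of_nonneg (Real.exp_pos _).le,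
    Real.exp_add, one_mul]
  have h1 : ‖(eps p : ℂ)‖ * ‖lam p‖ ^ k ≤ (k.factorial : ℝ) * Real.exp ‖lam p‖ := by
    refine (mul_le_of_le_one_left (pow_nonneg (norm_nonneg (lam p)) k) (norm_eps_le p)).trans ?_
    have := Real.pow_div_factorial_le_exp ‖lam p‖ (norm_nonneg _) k
    rwa [div_le_iff₀' (by positivity)] at this
  calc _ ≤ (k.factorial : ℝ) * Real.exp ‖lam p‖ * Real.exp (-(Real.pi * t * nrm p)) := by gcongr
    _ = _ := by ring

theorem summable_thetaPow_term (k : ℕ) {t : ℝ} (ht : 0 < t) : Summable fun p : ℤ × ℤ =>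
    (eps p : ℂ) * lam p ^ k * Real.exp (-(Real.pi * t * nrm p)) :=
  Summable.of_norm_bounded ((summable_exp_norm_lam ht 1).mul_left _) (norm_thetaPow_term_le k t)

theorem hasSum_heckeTheta (k : ℕ) {x : ℝ} (hx : 0 < x) : HasSum (fun p : ℤ × ℤ =>
    (eps p : ℂ) * lam p ^ k * Real.exp (-(2 * Real.pi / 7 * nrm p) * x)) (heckeTheta k x) := by
  have := (summable_thetaPow_term k (t := 2 * x / 7) (by positivity)).hasSum
  rw [heckeTheta, thetaPow]
  convert! this using 5 with p
  ring

theorem continuousOn_heckeTheta (k : ℕ) : ContinuousOn (heckeTheta k) (Set.Ioi 0) := by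
  intro x hx
  have hx : 0 < x := hx
  have h : ContinuousOn (heckeTheta k) (Set.Ioi (x / 2)) := by
    refine continuousOn_tsum (u := fun p => (k.factorial : ℝ) *
      Real.exp (-(Real.pi * (x / 7) * nrm p) + 1 * ‖lam p‖)) (fun p => by fun_prop)
      ((summable_exp_norm_lam (by positivity) 1).mul_left _) fun p y hy => ?_
    refine (norm_thetaPow_term_le k _ p).trans ?_
    have hy : x / 2 < y := hy
    have hN : (0 : ℝ) ≤ nrm p := by exact_mod_cast nrm_nonneg p
    gcongr
    linarith
  exact (h.continuousAt (Ioi_mem_nhds (by linarith))).continuousWithinAt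

theorem one_le_nrm {p : ℤ × ℤ} (hp : p ≠ (0, 0)) : (1 : ℝ) ≤ nrm p := by
  exact_mod_cast nrm_pos hp

theorem exists_norm_heckeTheta_le (k : ℕ) : ∃ C : ℝ, ∀ x : ℝ, 1 ≤ x →
    ‖heckeTheta k x‖ ≤ C * Real.exp (-(Real.pi / 7) * x) := by
  refine ⟨∑' p : ℤ × ℤ, (k.factorial : ℝ) * Real.exp (-(Real.pi * (1 / 7) * nrm p) + 1 * ‖lam p‖),
    fun x hx => ?_⟩
  rw [← tsum_mul_right]
  refine tsum_of_norm_bounded (((summable_exp_norm_lam (t := 1 / 7) (by norm_num) 1).mul_left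
    _).mul_right _).hasSum fun p => ?_
  by_cases hp : p = (0, 0)
  · rw [hp, eps_zero]
    simp only [Int.cast_zero, zero_mul, norm_zero]
    positivity
  refine (norm_thetaPow_term_le k _ p).trans ?_
  rw [mul_assoc (k.factorial : ℝ), ← Real.exp_add]
  refine mul_le_mul_of_nonneg_left (Real.exp_le_exp.2 ?_) (by positivity)
  have h1 := one_le_nrm hp
  -- Valid because `x` and the norm are both at least `1`; it separates the decay in `x` from a
  -- summable factor in `p`.
  have h2 : x + nrm p ≤ 2 * x * nrm p := by nlinarith
  have := mul_le_mul_of_nonneg_left h2 Real.pi_pos.le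
  nlinarith

/-- The functional equation pair of the theta series. -/
def heckePair (j : ℕ) : WeakFEPair ℂ where
  f := heckeTheta (4 * j + 1)
  g := heckeTheta (4 * j + 1)
  k := (4 * j + 2 : ℕ)
  ε := 1
  f₀ := 0
  g₀ := 0
  hf_int := (continuousOn_heckeTheta _).locallyIntegrableOn measurableSet_Ioi
  hg_int := (continuousOn_heckeTheta _).locallyIntegrableOn measurableSet_Ioi
  hk := by positivity
  hε := one_ne_zero
  h_feq x hx := by
    rw [heckeTheta_one_div j hx, one_mul, Real.rpow_natCast, smul_eq_mul]
    push_cast; rfl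
  hf_top r := by
    obtain ⟨C, hC⟩ := exists_norm_heckeTheta_le (4 * j + 1)
    simp only [sub_zero]
    refine IsBigO.trans ?_ (isLittleO_exp_neg_mul_rpow_atTop (a := Real.pi / 7)
      (by have := Real.pi_pos; positivity) r).isBigO
    refine IsBigO.of_bound C ?_
    filter_upwards [eventually_ge_atTop 1] with x hx
    rw [Real.norm_of_nonneg (Real.exp_pos _).le]
    exact hC x hx
  hg_top r := by
    obtain ⟨C, hC⟩ := exists_norm_heckeTheta_le (4 * j + 1)
    simp only [sub_zero]
    refine IsBigO.trans ?_ (isLittleO_exp_neg_mul_rpow_atTop (a := Real.pi / 7)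
      (by have := Real.pi_pos; positivity) r).isBigO
    refine IsBigO.of_bound C ?_
    filter_upwards [eventually_ge_atTop 1] with x hx
    rw [Real.norm_of_nonneg (Real.exp_pos _).le]
    exact hC x hx

/-- There are no constant terms at infinity, since `ε` kills the origin; hence the Mellin transform
has no poles. -/
theorem isStrongFEPair_heckePair (j : ℕ) : IsStrongFEPair (heckePair j) := ⟨rfl, rfl⟩

theorem differentiable_mellin_heckeTheta (j : ℕ) :
    Differentiable ℂ (mellin (heckeTheta (4 * j + 1))) := by
  have h := (isStrongFEPair_heckePair j).differentiable_Λ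
  rwa [(isStrongFEPair_heckePair j).Λ_eq] at h

theorem mellinConvergent_heckeTheta (j : ℕ) (s : ℂ) :
    MellinConvergent (heckeTheta (4 * j + 1)) s :=
  ((isStrongFEPair_heckePair j).hasMellin s).1

/-! ### Absolute convergence and entire continuation. -/

theorem summable_nrm_rpow {σ : ℝ} (hσ : 1 < σ) :
    Summable fun p : ℤ × ℤ => (nrm p : ℝ) ^ (-σ) := by
  have h := EisensteinSeries.summable_one_div_norm_rpow (k := 2 * σ) (by linarith)
  rw [← (finTwoArrowEquiv ℤ).symm.summable_iff] at h
  refine Summable.of_nonneg_of_le (fun p => Real.rpow_nonneg (by exact_mod_cast nrm_nonneg p) _)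
    (fun p => ?_) (h.mul_left (2 ^ σ))
  simp only [Function.comp_apply, finTwoArrowEquiv_symm_apply]
  by_cases hp : p = (0, 0)
  · rw [hp]
    simp only [nrm]
    norm_num
    rw [Real.zero_rpow (by linarith)]
    positivity
  have hN := one_le_nrm hp
  set v : Fin 2 → ℤ := ![p.1, p.2] with hv
  have hv0 : v ≠ 0 := by
    intro h0
    apply hp
    have h1 := congrFun h0 0
    have h2 := congrFun h0 1
    simp [hv] at h1 h2
    exact Prod.ext h1 h2
  have hvp : 0 < ‖v‖ := norm_pos_iff.2 hv0
  have hle : ‖v‖ ^ 2 ≤ 2 * nrm p := by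
    have := nrm_ge p
    have h2 : ‖v‖ ≤ √(2 * nrm p) := by
      rw [pi_norm_le_iff_of_nonneg (Real.sqrt_nonneg _)]
      intro i
      rw [Int.norm_eq_abs]
      apply Real.abs_le_sqrt
      fin_cases i <;> simp [hv] <;> nlinarith [sq_nonneg (p.1 : ℝ), sq_nonneg (p.2 : ℝ)]
    calc ‖v‖ ^ 2 ≤ √(2 * nrm p) ^ 2 := by gcongr
      _ = _ := Real.sq_sqrt (by linarith)
  have h3 : (2 * (nrm p : ℝ)) ^ (-σ) ≤ (‖v‖ ^ 2) ^ (-σ) :=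
    Real.rpow_le_rpow_of_nonpos (by positivity) hle (by linarith)
  rw [Real.mul_rpow (by norm_num) (by linarith), ← Real.rpow_natCast, ← Real.rpow_mul hvp.le,
    Real.rpow_neg (by norm_num)] at h3
  have h4 : ((2 : ℕ) : ℝ) * -σ = -(2 * σ) := by push_cast; ring
  rw [h4] at h3
  have h5 : (0 : ℝ) < 2 ^ σ := by positivity
  calc (nrm p : ℝ) ^ (-σ) = 2 ^ σ * ((2 ^ σ)⁻¹ * (nrm p : ℝ) ^ (-σ)) := by field_simp
    _ ≤ _ := by gcongr

theorem eps_pow_odd (p : ℤ × ℤ) (j : ℕ) : eps p ^ (4 * j + 1) = eps p := by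
  rw [eps_eq]
  rcases legendreSym_seven_trichotomy (2 * p.1 + p.2) with h | h | h <;> rw [h]
  · simp
  · simp
  · rw [pow_succ, pow_mul]; norm_num

theorem chi_pow (p : ℤ × ℤ) (j : ℕ) :
    chi p ^ (4 * j + 1) = (eps p : ℂ) * lam p ^ (4 * j + 1) := by
  rw [chi, mul_pow, ← Int.cast_pow, eps_pow_odd, lam]

/-- The entire continuation of `L(s, χ ^ (4 j + 1))` as a Mellin transform. -/
def heckeMellin (j : ℕ) (s : ℂ) : ℂ :=
  1 / 2 * ((2 * Real.pi / 7 : ℝ) : ℂ) ^ (s + ((4 * j + 1 : ℕ) : ℂ) / 2) *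
    (Gamma (s + ((4 * j + 1 : ℕ) : ℂ) / 2))⁻¹ *
    mellin (heckeTheta (4 * j + 1)) (s + ((4 * j + 1 : ℕ) : ℂ) / 2)

theorem two_pi_div_seven_pos : 0 < 2 * Real.pi / 7 := by have := Real.pi_pos; positivity

theorem eps_eq_zero_or_nrm_pos (p : ℤ × ℤ) : eps p = 0 ∨ 0 < nrm p := by
  by_cases hp : p = (0, 0)
  · left; rw [hp, eps_zero]
  · right; exact nrm_pos hp

/-- The Mellin transform taken term by term produces `Γ(s') (2 π N / 7) ^ (-s')` with `s' = s + k /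
2`. Dividing by `Γ` keeps the function entire because `1 / Γ` is entire. -/
theorem isHeckeL_heckeMellin (j : ℕ) : IsHeckeL (4 * j + 1) (heckeMellin j) := by
  have hc := two_pi_div_seven_pos
  have hc0 : ((2 * Real.pi / 7 : ℝ) : ℂ) ≠ 0 := by exact_mod_cast hc.ne'
  constructor
  · have h1 := differentiable_mellin_heckeTheta j
    have h2 := Complex.differentiable_one_div_Gamma
    have h3 : Differentiable ℂ fun s : ℂ => s + ((4 * j + 1 : ℕ) : ℂ) / 2 := by fun_prop
    have h4 : Differentiable ℂ fun s : ℂ => ((2 * Real.pi / 7 : ℝ) : ℂ) ^ s :=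
      fun s => (differentiableAt_id.const_cpow (Or.inl hc0))
    exact (((h4.comp h3).const_mul _).mul (h2.comp h3)).mul (h1.comp h3)
  · intro s hs
    set s' := s + ((4 * j + 1 : ℕ) : ℂ) / 2 with hs'
    have hre : s'.re = s.re + (4 * j + 1 : ℕ) / 2 := by
      simp [hs']
    have hpos : 0 < s'.re := by rw [hre]; positivity
    have hG : Gamma s' ≠ 0 := Complex.Gamma_ne_zero_of_re_pos hpos
    have hsum : Summable fun p : ℤ × ℤ => ‖(eps p : ℂ) * lam p ^ (4 * j + 1)‖ /
        (2 * Real.pi / 7 * nrm p) ^ s'.re := by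
      refine Summable.of_nonneg_of_le (fun p => ?_) (fun p => ?_)
        ((summable_nrm_rpow hs).mul_left (((2 * Real.pi / 7) ^ s'.re)⁻¹))
      · have : (0 : ℝ) ≤ nrm p := by exact_mod_cast nrm_nonneg p
        positivity
      · rcases eps_eq_zero_or_nrm_pos p with h | h
        · rw [h]
          have : (0 : ℝ) ≤ nrm p := by exact_mod_cast nrm_nonneg p
          simp only [Int.cast_zero, zero_mul, norm_zero, zero_div]
          positivity
        · have hN : (0 : ℝ) < nrm p := by exact_mod_cast h
          rw [Real.mul_rpow hc.le hN.le, div_eq_mul_inv, mul_inv, mul_left_comm]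
          gcongr
          rw [norm_mul, norm_pow]
          have hl : ‖lam p‖ ^ (4 * j + 1) = (nrm p : ℝ) ^ (((4 * j + 1 : ℕ) : ℝ) / 2) := by
            rw [← norm_lam_sq, ← Real.rpow_natCast, ← Real.rpow_natCast, ← Real.rpow_mul (norm_nonneg _)]
            congr 1; push_cast; ring
          rw [hl, hre, Real.rpow_add hN, mul_inv, Real.rpow_neg hN.le]
          have h0 : 0 < (nrm p : ℝ) ^ (((4 * j + 1 : ℕ) : ℝ) / 2) := by positivity
          have h1 : 0 < (nrm p : ℝ) ^ s.re := by positivity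
          calc _ ≤ 1 * (nrm p : ℝ) ^ (((4 * j + 1 : ℕ) : ℝ) / 2) *
                (((nrm p : ℝ) ^ s.re)⁻¹ * ((nrm p : ℝ) ^ (((4 * j + 1 : ℕ) : ℝ) / 2))⁻¹) := by
                gcongr; exact norm_eps_le p
            _ = _ := by field_simp
    have h := hasSum_mellin (ι := ℤ × ℤ) (a := fun p => (eps p : ℂ) * lam p ^ (4 * j + 1))
      (p := fun p => 2 * Real.pi / 7 * nrm p) (F := heckeTheta (4 * j + 1)) (s := s')
      (fun p => by
        rcases eps_eq_zero_or_nrm_pos p with h | h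
        · left; rw [h]; simp
        · right
          have hN : (0 : ℝ) < nrm p := by exact_mod_cast h
          positivity) hpos (fun t ht => hasSum_heckeTheta _ ht) hsum
    have h2 := h.mul_left (1 / 2 * ((2 * Real.pi / 7 : ℝ) : ℂ) ^ s' * (Gamma s')⁻¹)
    have h3 : HasSum (fun p : ℤ × ℤ => term (4 * j + 1) s p) (heckeMellin j s) := by
      refine h2.congr_fun fun p => ?_
      rw [term, chi_pow, ← hs']
      rcases eps_eq_zero_or_nrm_pos p with h | h
      · rw [h]; simp
      · have hN : (0 : ℝ) < nrm p := by exact_mod_cast h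
        have e1 : ((2 * Real.pi / 7 * nrm p : ℝ) : ℂ) ^ s' =
            ((2 * Real.pi / 7 : ℝ) : ℂ) ^ s' * (nrm p : ℂ) ^ s' := by
          rw [Complex.ofReal_mul, Complex.mul_cpow_ofReal_nonneg hc.le hN.le, Complex.ofReal_intCast]
        rw [e1]
        have e2 : ((2 * Real.pi / 7 : ℝ) : ℂ) ^ s' ≠ 0 := by
          rw [Ne, Complex.cpow_eq_zero_iff]; exact fun h => hc0 h.1
        generalize ((2 * Real.pi / 7 : ℝ) : ℂ) ^ s' = z at e2 ⊢
        field_simp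
    refine (hasSum_subtype_iff_of_support_subset (f := fun p => term (4 * j + 1) s p)
      (s := {p : ℤ × ℤ | p ≠ (0, 0)}) ?_).2 h3
    intro p hp hp0
    apply hp
    show term (4 * j + 1) s p = 0
    rw [hp0, term, chi, eps_zero]
    simp

theorem isHeckeL_heckeL (j : ℕ) : IsHeckeL (4 * j + 1) (heckeL (4 * j + 1)) :=
  Classical.epsilon_spec (p := IsHeckeL (4 * j + 1)) ⟨_, isHeckeL_heckeMellin j⟩

theorem heckeL_eq (j : ℕ) : heckeL (4 * j + 1) = heckeMellin j :=
  (isHeckeL_heckeL j).unique (isHeckeL_heckeMellin j)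

/-! ### Estimates for the incomplete Gamma weight. -/

/-- The regularised upper incomplete Gamma function `Γ(M, y) / Γ(M)` at a natural number `M`. -/
def gammaQ (M : ℕ) (y : ℝ) : ℝ := Real.exp (-y) * ∑ j ∈ range M, y ^ j / (j.factorial : ℝ)

theorem gammaQ_succ (M : ℕ) (y : ℝ) :
    gammaQ (M + 1) y = gammaQ M y + Real.exp (-y) * (y ^ M / (M.factorial : ℝ)) := by
  rw [gammaQ, sum_range_succ, mul_add, gammaQ]

theorem gammaQ_nonneg (M : ℕ) {y : ℝ} (hy : 0 ≤ y) : 0 ≤ gammaQ M y := by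
  unfold gammaQ; positivity

theorem gammaQ_le_one (M : ℕ) {y : ℝ} (hy : 0 ≤ y) : gammaQ M y ≤ 1 := by
  have := Real.sum_le_exp_of_nonneg hy M
  calc gammaQ M y ≤ Real.exp (-y) * Real.exp y := by unfold gammaQ; gcongr
    _ = 1 := by rw [← Real.exp_add]; simp

theorem gammaQ_mono {y : ℝ} (hy : 0 ≤ y) : Monotone fun M => gammaQ M y := by
  refine monotone_nat_of_le_succ fun M => ?_
  rw [gammaQ_succ]
  have : 0 ≤ Real.exp (-y) * (y ^ M / (M.factorial : ℝ)) := by positivity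
  linarith

theorem gammaQ_succ_zero (M : ℕ) : gammaQ (M + 1) 0 = 1 := by
  simp [gammaQ, sum_range_succ']

/-- Uses `y ^ j ≤ 2 ^ M (y / 2) ^ j`. The bound is wasteful in `M` and serves only for convergence
at fixed `M`. -/
theorem gammaQ_le_exp (M : ℕ) {y : ℝ} (hy : 0 ≤ y) : gammaQ M y ≤ 2 ^ M * Real.exp (-(y / 2)) := by
  have h1 : ∑ j ∈ range M, y ^ j / (j.factorial : ℝ) ≤ 2 ^ M * Real.exp (y / 2) := by
    calc ∑ j ∈ range M, y ^ j / (j.factorial : ℝ)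
        ≤ ∑ j ∈ range M, 2 ^ M * ((y / 2) ^ j / (j.factorial : ℝ)) := by
          refine sum_le_sum fun j hj => ?_
          have hj : j ≤ M := (mem_range.1 hj).le
          have : y ^ j = 2 ^ j * (y / 2) ^ j := by rw [← mul_pow]; congr 1; ring
          rw [this, mul_div_assoc]
          gcongr
          norm_num
      _ ≤ _ := by
          rw [← mul_sum]
          gcongr
          exact Real.sum_le_exp_of_nonneg (by positivity) M
  calc gammaQ M y ≤ Real.exp (-y) * (2 ^ M * Real.exp (y / 2)) := by unfold gammaQ; gcongr
    _ = 2 ^ M * (Real.exp (-y) * Real.exp (y / 2)) := by ring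
    _ = _ := by rw [← Real.exp_add]; congr 2; ring

/-- Multiplying by `y ^ 2` shifts the truncated exponential series by two, at the price of `(j + 1)
(j + 2) ≤ (M + 1) ^ 2`. The quadratic decay beyond `y ≈ M` is what the off-diagonal sum needs. -/
theorem sq_mul_gammaQ_le (M : ℕ) {y : ℝ} (hy : 0 ≤ y) : y ^ 2 * gammaQ M y ≤ ((M : ℝ) + 1) ^ 2 := by
  have h1 : y ^ 2 * ∑ j ∈ range M, y ^ j / (j.factorial : ℝ) ≤ ((M : ℝ) + 1) ^ 2 * Real.exp y := by
    calc y ^ 2 * ∑ j ∈ range M, y ^ j / (j.factorial : ℝ)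
        ≤ ∑ j ∈ range M, ((M : ℝ) + 1) ^ 2 * (y ^ (j + 2) / ((j + 2).factorial : ℝ)) := by
          rw [mul_sum]
          refine sum_le_sum fun j hj => ?_
          have hj : (j : ℝ) + 1 ≤ M := by exact_mod_cast mem_range.1 hj
          have e : y ^ 2 * (y ^ j / (j.factorial : ℝ)) =
              (((j : ℝ) + 2) * (j + 1)) * (y ^ (j + 2) / ((j + 2).factorial : ℝ)) := by
            rw [Nat.factorial_succ, Nat.factorial_succ]
            push_cast
            field_simp
            ring
          rw [e]
          gcongr
          nlinarith
      _ ≤ ((M : ℝ) + 1) ^ 2 * ∑ j ∈ range (M + 2), y ^ j / (j.factorial : ℝ) := by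
          rw [← mul_sum, sum_range_succ', sum_range_succ']
          gcongr
          have h0 : 0 ≤ y ^ (0 + 1) / ((0 + 1).factorial : ℝ) := by positivity
          have h1 : 0 ≤ y ^ 0 / (Nat.factorial 0 : ℝ) := by positivity
          linarith
      _ ≤ _ := by
          gcongr
          exact Real.sum_le_exp_of_nonneg hy _
  calc y ^ 2 * gammaQ M y = Real.exp (-y) * (y ^ 2 * ∑ j ∈ range M, y ^ j / (j.factorial : ℝ)) := by
        unfold gammaQ; ring
    _ ≤ Real.exp (-y) * (((M : ℝ) + 1) ^ 2 * Real.exp y) := by gcongr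
    _ = ((M : ℝ) + 1) ^ 2 * (Real.exp (-y) * Real.exp y) := by ring
    _ = _ := by rw [← Real.exp_add]; simp

theorem hasDerivAt_gammaQ_succ (m : ℕ) (y : ℝ) :
    HasDerivAt (gammaQ (m + 1)) (-(Real.exp (-y) * (y ^ m / (m.factorial : ℝ)))) y := by
  have hexp : HasDerivAt (fun y : ℝ => Real.exp (-y)) (-Real.exp (-y)) y := by
    simpa using (hasDerivAt_neg y).exp
  induction m with
  | zero =>
    have : gammaQ 1 = fun y => Real.exp (-y) := by funext y; simp [gammaQ]
    rw [this]; simpa using hexp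
  | succ m ih =>
    have e : gammaQ (m + 1 + 1) = fun y => gammaQ (m + 1) y +
        Real.exp (-y) * (y ^ (m + 1) / ((m + 1).factorial : ℝ)) := by
      funext y; exact gammaQ_succ _ _
    rw [e]
    convert! ih.add (hexp.mul ((hasDerivAt_pow (m + 1) y).div_const _)) using 1
    rw [Nat.factorial_succ]
    push_cast
    field_simp
    ring

theorem tendsto_gammaQ (M : ℕ) : Tendsto (gammaQ M) atTop (nhds 0) := by
  have h : Tendsto (fun y : ℝ => 2 ^ M * Real.exp (-(y / 2))) atTop (nhds (2 ^ M * 0)) :=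
    (Real.tendsto_exp_neg_atTop_nhds_zero.comp
      (tendsto_id.atTop_div_const (by norm_num : (0 : ℝ) < 2))).const_mul _
  rw [mul_zero] at h
  refine tendsto_of_tendsto_of_tendsto_of_le_of_le' tendsto_const_nhds h ?_ ?_
  · filter_upwards [eventually_ge_atTop 0] with y hy using gammaQ_nonneg M hy
  · filter_upwards [eventually_ge_atTop 0] with y hy using gammaQ_le_exp M hy

theorem antitoneOn_gammaQ (m : ℕ) : AntitoneOn (gammaQ (m + 1)) (Set.Ici 0) := by
  refine antitoneOn_of_deriv_nonpos (convex_Ici 0)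
    (fun y _ => (hasDerivAt_gammaQ_succ m y).continuousAt.continuousWithinAt)
    (fun y _ => (hasDerivAt_gammaQ_succ m y).differentiableAt.differentiableWithinAt) fun y hy => ?_
  rw [interior_Ici, Set.mem_Ioi] at hy
  rw [(hasDerivAt_gammaQ_succ m y).deriv]
  have : 0 ≤ Real.exp (-y) * (y ^ m / (m.factorial : ℝ)) := by positivity
  linarith

/-- This is Markov's inequality for a Poisson variable `X` of mean `y`, as `gammaQ M y` is the
probability of `X < M`. Analytically, `∑ gammaQ (i + 1) y + y` over `i < M` has derivative `1 -
gammaQ M y ≥ 0` and starts at `M`. -/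
theorem one_sub_gammaQ_le (M : ℕ) {y : ℝ} (hy : 0 ≤ y) : M * (1 - gammaQ M y) ≤ y := by
  have hd : ∀ y, HasDerivAt (fun y => ∑ i ∈ range M, gammaQ (i + 1) y + y) (1 - gammaQ M y) y := by
    intro y
    convert! (HasDerivAt.fun_sum fun i (_ : i ∈ range M) => hasDerivAt_gammaQ_succ i y).add
      (hasDerivAt_id y) using 1
    rw [gammaQ, mul_sum, sum_neg_distrib]; ring
  have hmono : MonotoneOn (fun y => ∑ i ∈ range M, gammaQ (i + 1) y + y) (Set.Ici 0) := by
    refine monotoneOn_of_deriv_nonneg (convex_Ici 0)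
      (fun y _ => (hd y).continuousAt.continuousWithinAt)
      (fun y _ => (hd y).differentiableAt.differentiableWithinAt) fun y hy => ?_
    rw [interior_Ici, Set.mem_Ioi] at hy
    rw [(hd y).deriv]
    linarith [gammaQ_le_one M hy.le]
  have h := hmono (Set.mem_Ici.2 le_rfl) (Set.mem_Ici.2 hy) hy
  simp only [gammaQ_succ_zero, sum_const, card_range, nsmul_eq_mul, mul_one, add_zero] at h
  have h2 : ∑ i ∈ range M, gammaQ (i + 1) y ≤ ∑ i ∈ range M, gammaQ M y :=
    sum_le_sum fun i hi => gammaQ_mono hy (mem_range.1 hi)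
  rw [sum_const, card_range, nsmul_eq_mul] at h2
  linarith

theorem hasDerivAt_gammaQ_mul (m : ℕ) {p : ℝ} (hp : 0 < p) (t : ℝ) :
    HasDerivAt (fun t => -((m.factorial : ℝ) / p ^ (m + 1) * gammaQ (m + 1) (p * t)))
      (t ^ m * Real.exp (-p * t)) t := by
  have h := ((hasDerivAt_gammaQ_succ m (p * t)).comp t
    ((hasDerivAt_id t).const_mul p)).const_mul ((m.factorial : ℝ) / p ^ (m + 1))
  convert! h.neg using 1
  simp only [mul_one]
  rw [mul_pow]
  field_simp
  ring

theorem integrableOn_pow_mul_exp (m : ℕ) {p : ℝ} (hp : 0 < p) :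
    MeasureTheory.IntegrableOn (fun t : ℝ => t ^ m * Real.exp (-p * t)) (Set.Ioi 1) ∧
    ∫ t in Set.Ioi (1 : ℝ), t ^ m * Real.exp (-p * t) =
      (m.factorial : ℝ) / p ^ (m + 1) * gammaQ (m + 1) p := by
  have hlim : Tendsto (fun t => -((m.factorial : ℝ) / p ^ (m + 1) * gammaQ (m + 1) (p * t)))
      atTop (nhds 0) := by
    have := (((tendsto_gammaQ (m + 1)).comp (tendsto_id.const_mul_atTop hp)).const_mul
      ((m.factorial : ℝ) / p ^ (m + 1))).neg
    simpa using this
  have hpos : ∀ t ∈ Set.Ioi (1 : ℝ), 0 ≤ t ^ m * Real.exp (-p * t) := by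
    intro t ht
    have : (0 : ℝ) < t := lt_trans one_pos ht
    positivity
  refine ⟨MeasureTheory.integrableOn_Ioi_deriv_of_nonneg'
    (fun t _ => hasDerivAt_gammaQ_mul m hp t) hpos hlim, ?_⟩
  rw [MeasureTheory.integral_Ioi_of_hasDerivAt_of_nonneg'
    (fun t _ => hasDerivAt_gammaQ_mul m hp t) hpos hlim]
  simp

/-! ### The exact formula for the central values. -/

/-- Folding the Mellin integral at the centre of symmetry. -/
theorem mellin_heckeTheta_center (j : ℕ) :
    mellin (heckeTheta (4 * j + 1)) (2 * j + 1) =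
      2 * ∫ t in Set.Ioi (1 : ℝ), (t : ℂ) ^ (2 * j) * heckeTheta (4 * j + 1) t := by
  set f := heckeTheta (4 * j + 1) with hf
  have hconv := mellinConvergent_heckeTheta j (2 * j + 1)
  rw [← hf] at hconv
  let g := (Set.Ioi (1 : ℝ)).indicator f
  let h := (Set.Iio (1 : ℝ)).indicator f
  have hg : mellin g (2 * j + 1) = ∫ t in Set.Ioi (1 : ℝ), (t : ℂ) ^ (2 * j) * f t := by
    rw [mellin]
    have e1 : ∀ t : ℝ, (t : ℂ) ^ ((2 * j + 1 : ℂ) - 1) • g t =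
        (Set.Ioi (1 : ℝ)).indicator (fun t : ℝ => (t : ℂ) ^ (2 * j) * f t) t := by
      intro t
      have e : (2 * j + 1 : ℂ) - 1 = ((2 * j : ℕ) : ℂ) := by push_cast; ring
      rw [e, Complex.cpow_natCast, smul_eq_mul]
      by_cases ht : t ∈ Set.Ioi (1 : ℝ)
      · simp only [g, Set.indicator_of_mem ht]
      · simp only [g, Set.indicator_of_notMem ht, mul_zero]
    simp_rw [e1]
    rw [MeasureTheory.setIntegral_indicator measurableSet_Ioi, Set.Ioi_inter_Ioi]
    simp
  have hh : mellin h (2 * j + 1) = ∫ t in Set.Ioc (0 : ℝ) 1, (t : ℂ) ^ ((2 * j + 1 : ℂ) - 1) • f t := by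
    rw [mellin, MeasureTheory.integral_Ioc_eq_integral_Ioo]
    have e1 : ∀ t : ℝ, (t : ℂ) ^ ((2 * j + 1 : ℂ) - 1) • h t =
        (Set.Iio (1 : ℝ)).indicator (fun t : ℝ => (t : ℂ) ^ ((2 * j + 1 : ℂ) - 1) • f t) t := by
      intro t
      by_cases ht : t ∈ Set.Iio (1 : ℝ)
      · simp only [h, Set.indicator_of_mem ht]
      · simp only [h, Set.indicator_of_notMem ht, smul_zero]
    simp_rw [e1]
    rw [MeasureTheory.setIntegral_indicator measurableSet_Iio]
    rfl
  -- The substitution `t ↦ 1 / t` exchanges the two halves: the weight is `4 j + 2`, so `2 j + 1` is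
  -- the fixed point of `s ↦ 4 j + 2 - s`.
  have hgh : mellin h (2 * j + 1) = mellin g (2 * j + 1) := by
    have e1 : mellin (fun t : ℝ => (t : ℂ) ^ (-(4 * j + 2) : ℂ) • g t⁻¹) (2 * j + 1) =
        mellin g (2 * j + 1) := by
      rw [mellin_cpow_smul (fun t => g t⁻¹), mellin_comp_inv]
      congr 1; ring
    rw [← e1, mellin, mellin]
    refine MeasureTheory.setIntegral_congr_fun measurableSet_Ioi fun t ht => ?_
    have ht : 0 < t := ht
    have ht0 : (t : ℂ) ≠ 0 := by exact_mod_cast ht.ne'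
    congr 1
    by_cases ht1 : t < 1
    · have h1 : 1 < t⁻¹ := (one_lt_inv₀ ht).2 ht1
      simp only [h, g, Set.indicator_of_mem (Set.mem_Iio.2 ht1), Set.indicator_of_mem (Set.mem_Ioi.2 h1)]
      have h2 := heckeTheta_one_div j ht
      rw [one_div] at h2
      rw [hf, h2, Complex.cpow_neg, smul_eq_mul,
        show (4 * j + 2 : ℂ) = ((4 * j + 2 : ℕ) : ℂ) by push_cast; ring, Complex.cpow_natCast]
      field_simp
    · have h1 : t⁻¹ ≤ 1 := inv_le_one_of_one_le₀ (not_lt.1 ht1)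
      simp only [h, g, Set.indicator_of_notMem (fun h => ht1 (Set.mem_Iio.1 h)),
        Set.indicator_of_notMem (fun h => absurd (Set.mem_Ioi.1 h) (not_lt.2 h1)), smul_zero]
  have hsplit : mellin f (2 * j + 1) = mellin h (2 * j + 1) + mellin g (2 * j + 1) := by
    rw [hh, hg, mellin]
    rw [← Set.Ioc_union_Ioi_eq_Ioi (zero_le_one' ℝ)]
    rw [MeasureTheory.setIntegral_union (Set.Ioc_disjoint_Ioi le_rfl) measurableSet_Ioi
      (hconv.mono_set Set.Ioc_subset_Ioi_self) (hconv.mono_set (Set.Ioi_subset_Ioi zero_le_one))]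
    congr 1
    refine MeasureTheory.setIntegral_congr_fun measurableSet_Ioi fun t _ => ?_
    have e : (2 * j + 1 : ℂ) - 1 = ((2 * j : ℕ) : ℂ) := by push_cast; ring
    rw [e, Complex.cpow_natCast, smul_eq_mul]
  rw [hsplit, hgh, hg]; ring

theorem hasSum_integral_heckeTheta (j : ℕ) :
    HasSum (fun p : ℤ × ℤ => (eps p : ℂ) * lam p ^ (4 * j + 1) *
      (((2 * j).factorial / (2 * Real.pi / 7 * nrm p) ^ (2 * j + 1) *
        gammaQ (2 * j + 1) (2 * Real.pi / 7 * nrm p) : ℝ) : ℂ))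
      (∫ t in Set.Ioi (1 : ℝ), (t : ℂ) ^ (2 * j) * heckeTheta (4 * j + 1) t) := by
  have hc := two_pi_div_seven_pos
  let F : ℤ × ℤ → ℝ → ℂ := fun p t => (eps p : ℂ) * lam p ^ (4 * j + 1) *
    ((t ^ (2 * j) * Real.exp (-(2 * Real.pi / 7 * nrm p) * t) : ℝ) : ℂ)
  have hint : ∀ p, MeasureTheory.Integrable (F p) (MeasureTheory.volume.restrict (Set.Ioi 1)) := by
    intro p
    rcases eps_eq_zero_or_nrm_pos p with h | h
    · have : F p = fun _ => 0 := by funext t; simp [F, h]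
      rw [this]; exact MeasureTheory.integrable_zero _ _ _
    · have hN : (0 : ℝ) < nrm p := by exact_mod_cast h
      exact ((integrableOn_pow_mul_exp (2 * j) (mul_pos hc hN)).1.ofReal).const_mul _
  have hnorm : ∀ p, ∫ t in Set.Ioi (1 : ℝ), ‖F p t‖ ≤
      (2 * j).factorial / (2 * Real.pi / 7) ^ (2 * j + 1) * 2 ^ (2 * j + 1) *
      ‖(eps p : ℂ) * lam p ^ (4 * j + 1) * Real.exp (-(Real.pi * (1 / 7) * nrm p))‖ := by
    intro p
    rcases eps_eq_zero_or_nrm_pos p with h | h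
    · simp [F, h]
    · have hN : (0 : ℝ) < nrm p := by exact_mod_cast h
      have hN1 : (1 : ℝ) ≤ nrm p := by exact_mod_cast h
      have e : ∫ t in Set.Ioi (1 : ℝ), ‖F p t‖ = ‖(eps p : ℂ) * lam p ^ (4 * j + 1)‖ *
          ∫ t in Set.Ioi (1 : ℝ), t ^ (2 * j) * Real.exp (-(2 * Real.pi / 7 * nrm p) * t) := by
        rw [← MeasureTheory.integral_const_mul]
        refine MeasureTheory.setIntegral_congr_fun measurableSet_Ioi fun t ht => ?_
        have : (0 : ℝ) < t := lt_trans one_pos ht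
        simp only [F]
        rw [norm_mul _ (Complex.ofReal _), Complex.norm_real, Real.norm_of_nonneg (by positivity)]
      rw [e, (integrableOn_pow_mul_exp (2 * j) (mul_pos hc hN)).2, norm_mul _ (Complex.ofReal _),
        Complex.norm_real, Real.norm_of_nonneg (Real.exp_pos _).le]
      have h1 := gammaQ_le_exp (2 * j + 1) (mul_pos hc hN).le
      have h2 : (2 * j).factorial / (2 * Real.pi / 7 * nrm p) ^ (2 * j + 1) ≤
          (2 * j).factorial / (2 * Real.pi / 7) ^ (2 * j + 1) := by
        gcongr
        nlinarith
      have h3 : -(2 * Real.pi / 7 * nrm p / 2) = -(Real.pi * (1 / 7) * nrm p) := by ring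
      rw [h3] at h1
      calc _ ≤ ‖(eps p : ℂ) * lam p ^ (4 * j + 1)‖ *
            ((2 * j).factorial / (2 * Real.pi / 7) ^ (2 * j + 1) *
              (2 ^ (2 * j + 1) * Real.exp (-(Real.pi * (1 / 7) * nrm p)))) := by
            gcongr
            exact gammaQ_nonneg _ (mul_pos hc hN).le
        _ = _ := by ring
  have hsum : Summable fun p => ∫ t in Set.Ioi (1 : ℝ), ‖F p t‖ :=
    Summable.of_nonneg_of_le (fun p => MeasureTheory.integral_nonneg fun _ => norm_nonneg _) hnorm
      (((summable_thetaPow_term (4 * j + 1) (by norm_num : (0 : ℝ) < 1 / 7)).norm).mul_left _)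
  have h := MeasureTheory.hasSum_integral_of_summable_integral_norm hint hsum
  have e2 : ∫ t in Set.Ioi (1 : ℝ), ∑' p, F p t =
      ∫ t in Set.Ioi (1 : ℝ), (t : ℂ) ^ (2 * j) * heckeTheta (4 * j + 1) t := by
    refine MeasureTheory.setIntegral_congr_fun measurableSet_Ioi fun t ht => ?_
    have ht0 : (0 : ℝ) < t := lt_trans one_pos ht
    rw [← (hasSum_heckeTheta (4 * j + 1) ht0).tsum_eq, ← tsum_mul_left]
    refine tsum_congr fun p => ?_
    simp only [F]
    push_cast; ring
  rw [e2] at h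
  refine h.congr_fun fun p => ?_
  simp only [F]
  rw [MeasureTheory.integral_const_mul, integral_complex_ofReal]
  rcases eps_eq_zero_or_nrm_pos p with h | h
  · simp [h]
  · have hN : (0 : ℝ) < nrm p := by exact_mod_cast h
    rw [(integrableOn_pow_mul_exp (2 * j) (mul_pos hc hN)).2]

/-- The exact formula for the central value as a rapidly converging series. -/
theorem hasSum_central_value (j : ℕ) :
    HasSum (fun p : ℤ × ℤ => (eps p : ℂ) * lam p ^ (4 * j + 1) / (nrm p : ℂ) ^ (2 * j + 1) *
      (gammaQ (2 * j + 1) (2 * Real.pi / 7 * nrm p) : ℂ)) (heckeL (4 * j + 1) (1 / 2)) := by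
  have hc := two_pi_div_seven_pos
  have hc0 : ((2 * Real.pi / 7 : ℝ) : ℂ) ≠ 0 := by exact_mod_cast hc.ne'
  have es : (1 / 2 : ℂ) + ((4 * j + 1 : ℕ) : ℂ) / 2 = 2 * j + 1 := by push_cast; ring
  have e2 : (2 * j + 1 : ℂ) = ((2 * j : ℕ) : ℂ) + 1 := by push_cast; ring
  have hval : heckeL (4 * j + 1) (1 / 2) = ((2 * Real.pi / 7 : ℝ) : ℂ) ^ (2 * j + 1) /
      ((2 * j).factorial : ℂ) *
      ∫ t in Set.Ioi (1 : ℝ), (t : ℂ) ^ (2 * j) * heckeTheta (4 * j + 1) t := by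
    rw [heckeL_eq, heckeMellin, es, mellin_heckeTheta_center, e2, Complex.Gamma_nat_eq_factorial,
      show ((2 * j : ℕ) : ℂ) + 1 = ((2 * j + 1 : ℕ) : ℂ) by push_cast; ring, Complex.cpow_natCast]
    ring
  rw [hval]
  refine ((hasSum_integral_heckeTheta j).mul_left _).congr_fun fun p => ?_
  rcases eps_eq_zero_or_nrm_pos p with h | h
  · simp [h]
  · have hN : (nrm p : ℂ) ≠ 0 := by exact_mod_cast h.ne'
    have hf : ((2 * j).factorial : ℂ) ≠ 0 := by exact_mod_cast (2 * j).factorial_ne_zero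
    generalize gammaQ (2 * j + 1) (2 * Real.pi / 7 * nrm p) = G
    generalize 2 * Real.pi / 7 = c at hc0
    push_cast
    rw [mul_pow]
    field_simp

/-! ### The value `L(1, (· / 7)) = π / √7` and the cost of smoothing it. -/

theorem sum_range_mul_eq_by_parts {R : Type*} [CommRing R] (a v : ℕ → R) (n : ℕ) :
    ∑ i ∈ range n, a i * v i = (∑ i ∈ range n, a i) * v n +
      ∑ i ∈ range n, (∑ l ∈ range (i + 1), a l) * (v i - v (i + 1)) := by
  induction n with
  | zero => simp
  | succ n ih =>
    rw [sum_range_succ, ih,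
      sum_range_succ (fun i => (∑ l ∈ range (i + 1), a l) * (v i - v (i + 1))) n, sum_range_succ a n]
    ring

theorem abs_sum_legendreSym_le (n : ℕ) :
    |∑ i ∈ range n, (legendreSym 7 (i + 1 : ℕ) : ℝ)| ≤ 2 := by
  obtain ⟨v0, v1, v2, v3, v4, v5, v6⟩ := legendreSym_seven_values
  have hp : ∀ q r : ℕ, legendreSym 7 ((7 * q + r : ℕ) : ℤ) = legendreSym 7 (r : ℤ) := by
    intro q r
    rw [← legendreSym_seven_add_mul r q]; congr 1; push_cast; ring
  have key : ∀ q r : ℕ, r ≤ 7 → ∑ i ∈ range (7 * q + r), legendreSym 7 (i + 1 : ℕ) =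
      ∑ i ∈ range r, legendreSym 7 (i + 1 : ℕ) := by
    intro q
    induction q with
    | zero => intro r _; simp
    | succ q ih =>
      intro r hr
      have h7 : ∑ i ∈ range (7 * q + 7), legendreSym 7 (i + 1 : ℕ) = 0 := by
        rw [ih 7 le_rfl]
        have v7 : legendreSym 7 7 = 0 := by simpa [v0] using hp 1 0
        simp [sum_range_succ, v1, v2, v3, v4, v5, v6, v7]
      rw [show 7 * (q + 1) + r = (7 * q + 7) + r by ring, sum_range_add, h7, zero_add]
      refine sum_congr rfl fun i _ => ?_
      rw [← hp (q + 1) (i + 1)]; congr 2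
  have h := key (n / 7) (n % 7) (Nat.mod_lt _ (by norm_num)).le
  rw [Nat.div_add_mod] at h
  have h2 : |∑ i ∈ range n, legendreSym 7 (i + 1 : ℕ)| ≤ 2 := by
    rw [h]
    have : n % 7 < 7 := Nat.mod_lt _ (by norm_num)
    interval_cases n % 7 <;> simp [sum_range_succ, v1, v2, v3, v4, v5, v6]
  exact_mod_cast h2

theorem abs_sum_legendreSym_mul_le {h : ℕ → ℝ} (hmono : Monotone h) (h0 : ∀ i, 0 ≤ h i)
    (h1 : ∀ i, h i ≤ 1) (n : ℕ) :
    |∑ i ∈ range n, (legendreSym 7 (i + 1 : ℕ) : ℝ) * (h i / (i + 1))| ≤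
      4 / (n + 1) + 4 * ∑ i ∈ range n, h i * (1 / ((i : ℝ) + 1) - 1 / ((i : ℝ) + 2)) := by
  rw [sum_range_mul_eq_by_parts]
  -- The increment is `X - Y` with `X, Y ≥ 0`, and `|X - Y| ≤ 2 Y + (X - Y)`, whose last part
  -- telescopes.
  have hk : ∀ i : ℕ, |h i / ((i : ℝ) + 1) - h (i + 1) / (((i + 1 : ℕ) : ℝ) + 1)| ≤
      2 * (h i * (1 / ((i : ℝ) + 1) - 1 / ((i : ℝ) + 2))) +
        (h (i + 1) / (((i + 1 : ℕ) : ℝ) + 1) - h i / ((i : ℝ) + 1)) := by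
    intro i
    have hm := hmono (Nat.le_succ i)
    have hd : 0 ≤ 1 / ((i : ℝ) + 1) - 1 / ((i : ℝ) + 2) := by
      rw [sub_nonneg]; gcongr; norm_num
    have e : h (i + 1) / (((i + 1 : ℕ) : ℝ) + 1) - h i / ((i : ℝ) + 1) =
        (h (i + 1) - h i) / ((i : ℝ) + 2) - h i * (1 / ((i : ℝ) + 1) - 1 / ((i : ℝ) + 2)) := by
      push_cast; field_simp; ring
    have e2 : 0 ≤ (h (i + 1) - h i) / ((i : ℝ) + 2) := div_nonneg (sub_nonneg.2 hm) (by positivity)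
    have e3 := mul_nonneg (h0 i) hd
    rw [abs_sub_comm, e, abs_le]
    constructor <;> linarith
  have hkn : h n / ((n : ℝ) + 1) ≤ 1 / (n + 1) := by gcongr; exact h1 n
  have hk0 : 0 ≤ h n / ((n : ℝ) + 1) := div_nonneg (h0 n) (by positivity)
  calc _ ≤ |(∑ i ∈ range n, (legendreSym 7 (i + 1 : ℕ) : ℝ)) * (h n / (n + 1))| +
        |∑ i ∈ range n, (∑ l ∈ range (i + 1), (legendreSym 7 (l + 1 : ℕ) : ℝ)) *
          (h i / ((i : ℝ) + 1) - h (i + 1) / (((i + 1 : ℕ) : ℝ) + 1))| := abs_add_le _ _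
    _ ≤ 2 * (h n / (n + 1)) + ∑ i ∈ range n,
          2 * (2 * (h i * (1 / ((i : ℝ) + 1) - 1 / ((i : ℝ) + 2))) +
            (h (i + 1) / (((i + 1 : ℕ) : ℝ) + 1) - h i / ((i : ℝ) + 1))) := by
        gcongr
        · rw [abs_mul, abs_of_nonneg hk0]
          gcongr; exact abs_sum_legendreSym_le n
        · refine (abs_sum_le_sum_abs _ _).trans (sum_le_sum fun i _ => ?_)
          rw [abs_mul]
          exact mul_le_mul (abs_sum_legendreSym_le _) (hk i) (abs_nonneg _) (by norm_num)
    _ ≤ _ := by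
        rw [← mul_sum, sum_add_distrib, ← mul_sum, sum_range_sub (fun i => h i / ((i : ℝ) + 1))]
        have hk00 : 0 ≤ h 0 / (((0 : ℕ) : ℝ) + 1) := div_nonneg (h0 0) (by positivity)
        have : 4 / ((n : ℝ) + 1) = 4 * (1 / (n + 1)) := by ring
        rw [this]
        linarith

theorem sum_mul_diff_le {h : ℕ → ℝ} (h0 : ∀ i, 0 ≤ h i) (h1 : ∀ i, h i ≤ 1) {δ : ℝ} (hδ : 0 < δ)
    (hle : ∀ i : ℕ, h i ≤ δ * ((i : ℝ) + 1) ^ 2) (n : ℕ) :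
    ∑ i ∈ range n, h i * (1 / ((i : ℝ) + 1) - 1 / ((i : ℝ) + 2)) ≤ 2 * √δ + δ := by
  -- Balances the two ranges: below `K` each term is at most `δ`, beyond `K` the differences
  -- telescope to at most `1 / (K + 1) ≤ √δ`.
  set K := ⌈1 / √δ⌉₊ with hK
  have hs : 0 < √δ := Real.sqrt_pos.2 hδ
  have hss : √δ * √δ = δ := Real.mul_self_sqrt hδ.le
  have hK1 : 1 / √δ ≤ K := Nat.le_ceil _
  have hK2 : (K : ℝ) < 1 / √δ + 1 := Nat.ceil_lt_add_one (by positivity)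
  have hd : ∀ i : ℕ, 0 ≤ 1 / ((i : ℝ) + 1) - 1 / ((i : ℝ) + 2) := by
    intro i; rw [sub_nonneg]; gcongr; norm_num
  have hnn : ∀ i : ℕ, 0 ≤ h i * (1 / ((i : ℝ) + 1) - 1 / ((i : ℝ) + 2)) :=
    fun i => mul_nonneg (h0 i) (hd i)
  have hA : ∑ i ∈ range K, h i * (1 / ((i : ℝ) + 1) - 1 / ((i : ℝ) + 2)) ≤ K * δ := by
    calc _ ≤ ∑ i ∈ range K, δ := by
          refine sum_le_sum fun i _ => ?_
          calc _ ≤ (δ * ((i : ℝ) + 1) ^ 2) * (1 / ((i : ℝ) + 1) - 1 / ((i : ℝ) + 2)) :=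
                mul_le_mul_of_nonneg_right (hle i) (hd i)
            _ = δ * (((i : ℝ) + 1) / (i + 2)) := by field_simp; ring
            _ ≤ δ * 1 := by
                gcongr
                rw [div_le_one (by positivity)]; linarith
            _ = δ := mul_one _
      _ = _ := by simp
  have hB : ∑ i ∈ range n, h (K + i) * (1 / (((K + i : ℕ) : ℝ) + 1) - 1 / (((K + i : ℕ) : ℝ) + 2)) ≤
      √δ := by
    calc _ ≤ ∑ i ∈ range n, -(1 / (((K + (i + 1) : ℕ) : ℝ) + 1) - 1 / (((K + i : ℕ) : ℝ) + 1)) := by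
          refine sum_le_sum fun i _ => ?_
          have := mul_le_mul_of_nonneg_right (h1 (K + i)) (hd (K + i))
          refine this.trans (le_of_eq ?_)
          push_cast; ring
      _ = 1 / ((K : ℝ) + 1) - 1 / (((K + n : ℕ) : ℝ) + 1) := by
          rw [sum_neg_distrib, sum_range_sub (fun i => 1 / (((K + i : ℕ) : ℝ) + 1))]
          simp
      _ ≤ 1 / ((K : ℝ) + 1) := by
          have : 0 ≤ 1 / (((K + n : ℕ) : ℝ) + 1) := by positivity
          linarith
      _ ≤ 1 / (1 / √δ) := by gcongr; linarith
      _ = √δ := by simp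
  calc _ ≤ ∑ i ∈ range (K + n), h i * (1 / ((i : ℝ) + 1) - 1 / ((i : ℝ) + 2)) :=
        sum_le_sum_of_subset_of_nonneg (range_subset_range.2 (Nat.le_add_left _ _)) fun i _ _ => hnn i
    _ ≤ K * δ + √δ := by rw [sum_range_add]; exact add_le_add hA hB
    _ ≤ (1 / √δ + 1) * δ + √δ := by gcongr
    _ = 2 * √δ + δ := by
        have : 1 / √δ * δ = √δ := by rw [← hss]; field_simp; simp
        linarith

theorem exists_tendsto_sum_legendreSym_div : ∃ L : ℝ, Tendsto
    (fun n => ∑ i ∈ range n, (legendreSym 7 (i + 1 : ℕ) : ℝ) * (1 / ((i : ℝ) + 1))) atTop (nhds L) := by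
  refine cauchySeq_tendsto_of_complete ?_
  have hf : Antitone fun i : ℕ => 1 / ((i : ℝ) + 1) := by
    intro a b hab
    simp only
    gcongr
  have := hf.cauchySeq_series_mul_of_tendsto_zero_of_bounded tendsto_one_div_add_atTop_nhds_zero_nat
    (z := fun i => (legendreSym 7 (i + 1 : ℕ) : ℝ)) (b := 2)
    (fun n => by rw [Real.norm_eq_abs]; exact abs_sum_legendreSym_le n)
  simpa [mul_comm] using this

/-- Smoothing the series `∑ (m / 7) / m` by a weight close to `1` hardly changes its sum. -/
theorem abs_smoothed_sub_le {L : ℝ} (hL : Tendsto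
    (fun n => ∑ i ∈ range n, (legendreSym 7 (i + 1 : ℕ) : ℝ) * (1 / ((i : ℝ) + 1))) atTop (nhds L))
    {g : ℕ → ℝ} (hanti : Antitone g) (g0 : ∀ i, 0 ≤ g i) (g1 : ∀ i, g i ≤ 1) {δ : ℝ} (hδ : 0 < δ)
    (hle : ∀ i : ℕ, 1 - g i ≤ δ * ((i : ℝ) + 1) ^ 2) {D : ℝ}
    (hD : HasSum (fun i : ℕ => (legendreSym 7 (i + 1 : ℕ) : ℝ) * (g i / (i + 1))) D) :
    |L - D| ≤ 4 * (2 * √δ + δ) := by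
  have hlim := (hL.sub hD.tendsto_sum_nat).abs
  have hlim2 : Tendsto (fun n : ℕ => 4 * (1 / ((n : ℝ) + 1)) + 4 * (2 * √δ + δ)) atTop
      (nhds (4 * 0 + 4 * (2 * √δ + δ))) :=
    (tendsto_one_div_add_atTop_nhds_zero_nat.const_mul 4).add_const _
  rw [mul_zero, zero_add] at hlim2
  refine le_of_tendsto_of_tendsto' hlim hlim2 fun n => ?_
  rw [← sum_sub_distrib]
  have h := abs_sum_legendreSym_mul_le (h := fun i => 1 - g i)
    (fun a b hab => sub_le_sub_left (hanti hab) 1)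
    (fun i => sub_nonneg.2 (g1 i)) (fun i => by linarith [g0 i]) n
  have h2 := sum_mul_diff_le (h := fun i => 1 - g i)
    (fun i => sub_nonneg.2 (g1 i)) (fun i => by linarith [g0 i]) hδ hle n
  have e : ∑ i ∈ range n, ((legendreSym 7 (i + 1 : ℕ) : ℝ) * (1 / ((i : ℝ) + 1)) -
      (legendreSym 7 (i + 1 : ℕ) : ℝ) * (g i / (i + 1))) =
      ∑ i ∈ range n, (legendreSym 7 (i + 1 : ℕ) : ℝ) * ((1 - g i) / (i + 1)) :=
    sum_congr rfl fun i _ => by ring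
  rw [e]
  refine h.trans ?_
  have : 4 / ((n : ℝ) + 1) = 4 * (1 / (n + 1)) := by ring
  rw [this]
  gcongr

/-- Because `1 - exp (2 i α) = 2 sin α · exp (i (α - π / 2))` with `sin α > 0`. -/
theorem arg_one_sub_exp {α : ℝ} (h0 : 0 < α) (h1 : α < Real.pi) :
    (1 - cexp (2 * α * I)).arg = α - Real.pi / 2 := by
  have hs := Real.sin_pos_of_pos_of_lt_pi h0 h1
  have e : 1 - cexp (2 * α * I) = ((2 * Real.sin α : ℝ) : ℂ) *
      (Complex.cos ((α - Real.pi / 2 : ℝ) : ℂ) + Complex.sin ((α - Real.pi / 2 : ℝ) : ℂ) * I) := by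
    rw [← Complex.ofReal_cos, ← Complex.ofReal_sin, Real.cos_sub_pi_div_two, Real.sin_sub_pi_div_two]
    rw [show (2 * α * I : ℂ) = ((2 * α : ℝ) : ℂ) * I by push_cast; ring, Complex.exp_mul_I,
      ← Complex.ofReal_cos, ← Complex.ofReal_sin, Real.cos_two_mul, Real.sin_two_mul]
    have hsc := Real.sin_sq_add_cos_sq α
    generalize Real.sin α = s at hsc
    generalize Real.cos α = c at hsc
    have hsc' : (s : ℂ) ^ 2 + (c : ℂ) ^ 2 = 1 := by exact_mod_cast hsc
    push_cast
    linear_combination -2 * hsc'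
  rw [e, Complex.arg_mul_cos_add_sin_mul_I (by positivity)
    ⟨by linarith, by linarith [Real.pi_pos]⟩]

/-- The Fourier expansion of the symbol writes the series through `log (1 - r ζ ^ c)`. The Gauss sum
is purely imaginary and the series real, so only the arguments survive. -/
theorem hasSum_legendreSym_pow_div {r : ℝ} (hr0 : 0 ≤ r) (hr1 : r < 1) :
    HasSum (fun i : ℕ => (legendreSym 7 (i + 1 : ℕ) : ℝ) * (r ^ (i + 1) / (i + 1)))
      (-(1 / √7) * ∑ c ∈ range 7, (legendreSym 7 (c : ℤ) : ℝ) * (1 - r * zeta ^ c).arg) := by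
  have h7 : ((√7 : ℝ) : ℂ) ≠ 0 := by
    rw [Ne, ofReal_eq_zero]; positivity
  have hz : ‖zeta‖ = 1 := by
    rw [zeta, show (2 * Real.pi * I / 7 : ℂ) = ((2 * Real.pi / 7 : ℝ) : ℂ) * I by push_cast; ring]
    exact Complex.norm_exp_ofReal_mul_I _
  have hc : ∀ c : ℕ, HasSum (fun n : ℕ => (r * zeta ^ c : ℂ) ^ n / n) (-log (1 - r * zeta ^ c)) := by
    intro c
    refine Complex.hasSum_taylorSeries_neg_log ?_
    rw [norm_mul, norm_pow, hz, one_pow, mul_one, Complex.norm_real, Real.norm_of_nonneg hr0]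
    exact hr1
  have h := (hasSum_sum (s := range 7) fun c _ => (hc c).mul_left (legendreSym 7 (c : ℤ) : ℂ)).mul_left
    (1 / (I * (√7 : ℝ)))
  have h2 : HasSum (fun n : ℕ => (((legendreSym 7 (n : ℕ) : ℝ) * (r ^ n / n) : ℝ) : ℂ))
      (1 / (I * (√7 : ℝ)) * ∑ c ∈ range 7, (legendreSym 7 (c : ℤ) : ℂ) * -log (1 - r * zeta ^ c)) := by
    refine h.congr_fun fun n => ?_
    have hf := legendreSym_fourier (n : ℤ)
    have e : ∑ c ∈ range 7, (legendreSym 7 (c : ℤ) : ℂ) * ((r * zeta ^ c : ℂ) ^ n / n) =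
        (∑ c ∈ range 7, (legendreSym 7 (c : ℤ) : ℂ) * cexp (2 * Real.pi * I * (c * (n : ℤ) / 7))) *
          ((r : ℂ) ^ n / n) := by
      rw [sum_mul]
      refine sum_congr rfl fun c _ => ?_
      rw [exp_eq_zeta_pow, zpow_natCast, mul_pow, ← pow_mul, ← pow_mul, mul_comm c n]
      ring
    rw [e, hf]
    push_cast
    field_simp
  have h3 := Complex.hasSum_re h2
  simp only [Complex.ofReal_re] at h3
  rw [← hasSum_nat_add_iff' 1] at h3
  convert! h3 using 1
  · funext i; push_cast; ring
  · have hre : ∀ z : ℂ, (1 / (I * (√7 : ℝ)) * z).re = (1 / √7) * z.im := by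
      intro z
      rw [show 1 / (I * (√7 : ℝ)) * z = ((1 / √7 : ℝ) : ℂ) * (-I * z) by
        push_cast; field_simp; rw [I_sq]; ring]
      rw [Complex.re_ofReal_mul]; simp
    rw [hre, Complex.im_sum]
    simp only [sum_range_one, Nat.cast_zero, div_zero, mul_zero, sub_zero]
    rw [neg_mul, ← mul_neg, ← sum_neg_distrib]
    congr 1
    refine sum_congr rfl fun c _ => ?_
    rw [← Complex.ofReal_intCast, Complex.im_ofReal_mul, Complex.neg_im, Complex.log_im]
    ring

/-- The limit comes from `∑ (c / 7) = 0` and `∑ (c / 7) c = -7`; `c = 0`, where the argument would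
be problematic, has symbol `0`. -/
theorem tendsto_arg_sum : Tendsto (fun r : ℝ => -(1 / √7) *
    ∑ c ∈ range 7, (legendreSym 7 (c : ℤ) : ℝ) * (1 - r * zeta ^ c).arg) (nhdsWithin 1 (Set.Iio 1))
    (nhds (Real.pi / √7)) := by
  obtain ⟨v0, v1, v2, v3, v4, v5, v6⟩ := legendreSym_seven_values
  have hpi := Real.pi_pos
  have hz : ∀ c : ℕ, zeta ^ c = cexp (2 * (Real.pi * c / 7 : ℝ) * I) := by
    intro c
    rw [zeta, ← Complex.exp_nat_mul]; congr 1; push_cast; ring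
  have hval : ∀ c : ℕ, 0 < c → c < 7 →
      ((1 - zeta ^ c).arg = Real.pi * c / 7 - Real.pi / 2) ∧ 1 - zeta ^ c ∈ slitPlane := by
    intro c hc hc7
    have hc' : (0 : ℝ) < c := by exact_mod_cast hc
    have hc7' : (c : ℝ) < 7 := by exact_mod_cast hc7
    have ha : (1 - zeta ^ c).arg = Real.pi * c / 7 - Real.pi / 2 := by
      rw [hz]
      exact arg_one_sub_exp (by positivity) (by rw [div_lt_iff₀ (by norm_num)]; nlinarith)
    refine ⟨ha, ?_⟩
    rw [mem_slitPlane_iff_arg]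
    constructor
    · rw [ha]; nlinarith
    · intro h0
      have := (Complex.isPrimitiveRoot_exp 7 (by norm_num)).pow_ne_one_of_pos_of_lt hc.ne' hc7
      apply this
      rw [sub_eq_zero] at h0
      rw [h0, zeta]; norm_num
  have hlim : ∀ c : ℕ, c ∈ range 7 → Tendsto (fun r : ℝ => (legendreSym 7 (c : ℤ) : ℝ) *
      (1 - r * zeta ^ c).arg) (nhdsWithin 1 (Set.Iio 1))
      (nhds ((legendreSym 7 (c : ℤ) : ℝ) * (Real.pi * c / 7 - Real.pi / 2))) := by
    intro c hc
    rcases Nat.eq_zero_or_pos c with rfl | hc0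
    · simp [v0]
    · obtain ⟨ha, hsl⟩ := hval c hc0 (mem_range.1 hc)
      have hcont : ContinuousAt (fun r : ℝ => (1 - (r : ℂ) * zeta ^ c).arg) 1 := by
        refine ContinuousAt.comp (g := Complex.arg) ?_ (by fun_prop)
        simpa using Complex.continuousAt_arg hsl
      have := hcont.tendsto
      simp only [Complex.ofReal_one, one_mul, ha] at this
      exact (this.mono_left nhdsWithin_le_nhds).const_mul _
  have h := (tendsto_finsetSum (range 7) hlim).const_mul (-(1 / √7))
  convert h using 2
  simp [sum_range_succ, v0, v1, v2, v3, v4, v5, v6]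
  ring

/-- Dirichlet's class number formula for `ℚ(√-7)`, as the sum of a conditionally convergent series. -/
theorem tendsto_sum_legendreSym_div : Tendsto
    (fun n => ∑ i ∈ range n, (legendreSym 7 (i + 1 : ℕ) : ℝ) * (1 / ((i : ℝ) + 1))) atTop
    (nhds (Real.pi / √7)) := by
  obtain ⟨L, hL⟩ := exists_tendsto_sum_legendreSym_div
  -- Abel summation as a case of the smoothing estimate: weight `r ^ (i + 1)` and `δ = 1 - r`, by
  -- Bernoulli's inequality.
  have hbound : ∀ r : ℝ, r ∈ Set.Ioo (0 : ℝ) 1 → |L - (-(1 / √7) *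
      ∑ c ∈ range 7, (legendreSym 7 (c : ℤ) : ℝ) * (1 - r * zeta ^ c).arg)| ≤
      4 * (2 * √(1 - r) + (1 - r)) := by
    rintro r ⟨hr0, hr1⟩
    refine abs_smoothed_sub_le hL (g := fun i => r ^ (i + 1))
      (fun a b hab => pow_le_pow_of_le_one hr0.le hr1.le (by omega)) (fun i => by positivity)
      (fun i => pow_le_one₀ hr0.le hr1.le) (sub_pos.2 hr1) (fun i => ?_)
      (hasSum_legendreSym_pow_div hr0.le hr1)
    have hb := one_add_mul_le_pow (a := r - 1) (by linarith) (i + 1)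
    rw [add_sub_cancel] at hb
    push_cast at hb
    have hi : (0 : ℝ) ≤ i := Nat.cast_nonneg i
    have : (1 - r) * ((i : ℝ) + 1) ≤ (1 - r) * ((i : ℝ) + 1) ^ 2 := by
      refine mul_le_mul_of_nonneg_left ?_ (by linarith)
      nlinarith
    nlinarith
  have h1 : Tendsto (fun r : ℝ => |L - (-(1 / √7) *
      ∑ c ∈ range 7, (legendreSym 7 (c : ℤ) : ℝ) * (1 - r * zeta ^ c).arg)|)
      (nhdsWithin 1 (Set.Iio 1)) (nhds |L - Real.pi / √7|) := (tendsto_arg_sum.const_sub L).abs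
  have h2 : Tendsto (fun r : ℝ => 4 * (2 * √(1 - r) + (1 - r))) (nhdsWithin 1 (Set.Iio 1))
      (nhds 0) := by
    have : ContinuousAt (fun r : ℝ => 4 * (2 * √(1 - r) + (1 - r))) 1 := by fun_prop
    have h := this.tendsto.mono_left (nhdsWithin_le_nhds (s := Set.Iio 1))
    simpa using h
  have h3 : |L - Real.pi / √7| ≤ 0 := by
    refine le_of_tendsto_of_tendsto h1 h2 ?_
    filter_upwards [Ioo_mem_nhdsLT (zero_lt_one' ℝ)] with r hr using hbound r hr
  have h4 : L = Real.pi / √7 := by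
    rw [← sub_eq_zero, ← abs_nonpos_iff]; exact h3
  rwa [h4] at hL

/-! ### The diagonal `b = 0`: the main term. -/

/-- The summand of the central value series. -/
def centralTerm (j : ℕ) (p : ℤ × ℤ) : ℂ :=
  (eps p : ℂ) * lam p ^ (4 * j + 1) / (nrm p : ℂ) ^ (2 * j + 1) *
    (gammaQ (2 * j + 1) (2 * Real.pi / 7 * nrm p) : ℂ)

theorem hasSum_int_of_even {E : Type*} [NormedRing E] {F : ℤ → E} (he : ∀ n, F (-n) = F n)
    (h0 : F 0 = 0) {T : E} (hT : HasSum (fun n : ℕ => F ((n : ℤ) + 1)) T) : HasSum F (2 * T) := by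
  have h1 : HasSum (fun n : ℕ => F (n : ℤ)) T := by
    rw [← hasSum_nat_add_iff' 1]
    simpa [h0] using hT
  have h2 : HasSum (fun n : ℕ => F (-((n : ℤ) + 1))) T := by simpa only [he] using hT
  rw [two_mul]
  exact HasSum.of_nat_of_neg_add_one h1 h2

theorem centralTerm_real (j : ℕ) (a : ℤ) : centralTerm j (a, 0) =
    (((legendreSym 7 a : ℝ) * (gammaQ (2 * j + 1) (2 * Real.pi / 7 * a ^ 2) / a) : ℝ) : ℂ) := by
  have e1 : eps (a, 0) = legendreSym 7 a := by rw [eps_eq']; simp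
  have e2 : nrm (a, 0) = a ^ 2 := by simp [nrm]
  rw [centralTerm, e1, e2]
  rcases eq_or_ne a 0 with rfl | ha
  · simp
  · have ha' : (a : ℂ) ≠ 0 := by exact_mod_cast ha
    simp only [lam]
    push_cast
    generalize (gammaQ (2 * j + 1) (2 * Real.pi / 7 * a ^ 2) : ℂ) = G
    rw [zero_mul, add_zero]
    field_simp
    ring

theorem real_part_bound (j : ℕ) :
    ‖∑' a : ℤ, centralTerm j (a, 0) - ((2 * Real.pi / √7 : ℝ) : ℂ)‖ ≤ 24 / √(2 * j + 1) := by
  have hc := two_pi_div_seven_pos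
  have hsum : Summable fun a : ℤ => centralTerm j (a, 0) :=
    (hasSum_central_value j).summable.comp_injective (i := fun a : ℤ => ((a, 0) : ℤ × ℤ))
      fun a b h => congrArg Prod.fst h
  let F : ℤ → ℝ := fun a => (legendreSym 7 a : ℝ) * (gammaQ (2 * j + 1) (2 * Real.pi / 7 * a ^ 2) / a)
  have hFs : Summable F := by
    have : Summable fun a => ((F a : ℝ) : ℂ) := hsum.congr fun a => (centralTerm_real j a)
    exact Complex.summable_ofReal.1 this
  have hF1 : Summable fun n : ℕ => F ((n : ℤ) + 1) :=
    hFs.comp_injective (i := fun n : ℕ => (n : ℤ) + 1) fun a b h => by simpa using h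
  set D := ∑' n : ℕ, F ((n : ℤ) + 1) with hD
  have hF2 : HasSum F (2 * D) := by
    refine hasSum_int_of_even (fun n => ?_) ?_ hF1.hasSum
    · simp only [F, legendreSym_seven_neg]
      push_cast
      rw [neg_sq]; ring
    · simp [F]
  have hval : ∑' a : ℤ, centralTerm j (a, 0) = ((2 * D : ℝ) : ℂ) := by
    rw [← hF2.tsum_eq, Complex.ofReal_tsum]
    exact tsum_congr fun a => centralTerm_real j a
  rw [hval, ← Complex.ofReal_sub, Complex.norm_real, Real.norm_eq_abs]
  have hM : (0 : ℝ) < 2 * j + 1 := by positivity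
  have hpi : 2 * Real.pi / 7 < 1 := by linarith [Real.pi_lt_d2]
  -- The constant that `one_sub_gammaQ_le` supplies at `y = 2 π a ^ 2 / 7`. As `δ ≤ √δ`, the error
  -- `2 · 4 (2 √δ + δ)` is at most `24 √δ`.
  set δ : ℝ := 2 * Real.pi / 7 / (2 * j + 1) with hδ
  have hδ0 : 0 < δ := by positivity
  have hδ1 : δ ≤ 1 / (2 * j + 1) := by rw [hδ]; gcongr
  have key : |Real.pi / √7 - D| ≤ 4 * (2 * √δ + δ) := by
    refine abs_smoothed_sub_le tendsto_sum_legendreSym_div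
      (g := fun i => gammaQ (2 * j + 1) (2 * Real.pi / 7 * ((i : ℝ) + 1) ^ 2))
      (fun a b hab => ?_) (fun i => gammaQ_nonneg _ (by positivity))
      (fun i => gammaQ_le_one _ (by positivity)) hδ0 (fun i => ?_) ?_
    · refine antitoneOn_gammaQ (2 * j) (Set.mem_Ici.2 (by positivity)) (Set.mem_Ici.2 (by positivity)) ?_
      gcongr
    · have := one_sub_gammaQ_le (2 * j + 1) (y := 2 * Real.pi / 7 * ((i : ℝ) + 1) ^ 2) (by positivity)
      push_cast at this
      have e : δ * ((i : ℝ) + 1) ^ 2 = 2 * Real.pi / 7 * ((i : ℝ) + 1) ^ 2 / (2 * j + 1) := by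
        rw [hδ]; ring
      rw [e, le_div_iff₀ hM]
      linarith
    · refine hF1.hasSum.congr_fun fun n => ?_
      simp only [F]
      push_cast; rfl
  have hs1 : √δ ≤ 1 / √(2 * j + 1) := by
    rw [← Real.sqrt_one, ← Real.sqrt_div zero_le_one, Real.sqrt_one]
    exact Real.sqrt_le_sqrt hδ1
  have hs2 : δ ≤ √δ := by
    have : δ ≤ 1 := hδ1.trans (by rw [div_le_one hM]; linarith [(Nat.cast_nonneg j : (0 : ℝ) ≤ j)])
    rw [Real.le_sqrt' hδ0]
    nlinarith
  have e : 2 * D - 2 * Real.pi / √7 = -2 * (Real.pi / √7 - D) := by ring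
  rw [e, abs_mul, abs_neg, abs_two]
  have e2 : 24 / √(2 * j + 1) = 24 * (1 / √(2 * j + 1)) := by ring
  rw [e2]
  linarith

/-! ### The off-diagonal terms `b ≠ 0`. -/

theorem norm_geom_sum_le {w : ℂ} (hw : ‖w‖ = 1) (h1 : w ≠ 1) (n : ℕ) :
    ‖∑ l ∈ range n, w ^ l‖ ≤ 2 / ‖w - 1‖ := by
  rw [geom_sum_eq h1, norm_div]
  gcongr
  calc ‖w ^ n - 1‖ ≤ ‖w ^ n‖ + ‖(1 : ℂ)‖ := norm_sub_le _ _
    _ = 2 := by rw [norm_pow, hw]; norm_num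

/-- Partial summation: the boundary term and the total variation of `q` each cost at most `2 / ‖w -
1‖ * q n`. -/
theorem norm_sum_pow_mul_le {w : ℂ} (hw : ‖w‖ = 1) (h1 : w ≠ 1) {q : ℕ → ℝ} (hq : Monotone q)
    (h0 : ∀ j, 0 ≤ q j) (n : ℕ) :
    ‖∑ j ∈ range n, w ^ j * (q j : ℂ)‖ ≤ 4 / ‖w - 1‖ * q n := by
  rw [sum_range_mul_eq_by_parts]
  have hB := norm_geom_sum_le hw h1
  calc _ ≤ ‖(∑ i ∈ range n, w ^ i) * (q n : ℂ)‖ +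
        ∑ i ∈ range n, ‖(∑ l ∈ range (i + 1), w ^ l) * ((q i : ℂ) - (q (i + 1) : ℂ))‖ :=
        (norm_add_le _ _).trans (add_le_add le_rfl (norm_sum_le _ _))
    _ ≤ 2 / ‖w - 1‖ * q n + ∑ i ∈ range n, 2 / ‖w - 1‖ * (q (i + 1) - q i) := by
        gcongr with i hi
        · rw [norm_mul, Complex.norm_real, Real.norm_of_nonneg (h0 n)]
          exact mul_le_mul_of_nonneg_right (hB n) (h0 n)
        · rw [norm_mul, ← Complex.ofReal_sub, Complex.norm_real, Real.norm_eq_abs, abs_sub_comm,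
            abs_of_nonneg (sub_nonneg.2 (hq (Nat.le_succ i)))]
          exact mul_le_mul_of_nonneg_right (hB _) (sub_nonneg.2 (hq (Nat.le_succ i)))
    _ ≤ _ := by
        rw [← mul_sum, sum_range_sub]
        have h2 : 0 ≤ 2 / ‖w - 1‖ * q 0 := mul_nonneg (by positivity) (h0 0)
        have e : 4 / ‖w - 1‖ = 2 * (2 / ‖w - 1‖) := by ring
        rw [e]; linarith

/-- The weight majorising the incomplete Gamma function. -/
def cutoff (R : ℕ) (x : ℤ) : ℝ := min 1 ((R : ℝ) ^ 2 / (x : ℝ) ^ 2)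

theorem cutoff_nonneg (R : ℕ) (x : ℤ) : 0 ≤ cutoff R x := le_min zero_le_one (by positivity)

theorem cutoff_neg (R : ℕ) (x : ℤ) : cutoff R (-x) = cutoff R x := by simp [cutoff]

/-- Division by zero gives `0`, so sums over all of `ℤ` silently omit `x = 0`. -/
theorem cutoff_zero (R : ℕ) : cutoff R 0 = 0 := by simp [cutoff]

theorem cutoff_le_tail {R : ℕ} (hR : 1 ≤ R) (i : ℕ) :
    cutoff R (((R + i : ℕ) : ℤ) + 1) ≤
      (R : ℝ) ^ 2 * (1 / ((R + i : ℕ) : ℝ) - 1 / ((R + (i + 1) : ℕ) : ℝ)) := by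
  have h1 : (0 : ℝ) < R := by exact_mod_cast hR
  refine (min_le_right _ _).trans ?_
  rw [div_eq_mul_one_div]
  gcongr
  push_cast
  have hi : (0 : ℝ) ≤ i := Nat.cast_nonneg i
  rw [div_sub_div _ _ (by positivity) (by positivity), div_le_div_iff₀ (by positivity) (by positivity)]
  nlinarith

theorem sum_tail_le {R : ℕ} (hR : 1 ≤ R) (n : ℕ) :
    ∑ i ∈ range n, (1 / ((R + i : ℕ) : ℝ) - 1 / ((R + (i + 1) : ℕ) : ℝ)) ≤ 1 / R := by
  rw [← neg_le_neg_iff, ← sum_neg_distrib]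
  simp_rw [neg_sub]
  rw [sum_range_sub (fun i => 1 / ((R + i : ℕ) : ℝ))]
  have : 0 ≤ 1 / ((R + n : ℕ) : ℝ) := by positivity
  simp only [add_zero]
  linarith

theorem sum_cutoff_le {R : ℕ} (hR : 1 ≤ R) (n : ℕ) :
    ∑ i ∈ range n, cutoff R ((i : ℤ) + 1) ≤ 2 * R := by
  have h1 : (0 : ℝ) < R := by exact_mod_cast hR
  calc _ ≤ ∑ i ∈ range (R + n), cutoff R ((i : ℤ) + 1) :=
        sum_le_sum_of_subset_of_nonneg (range_subset_range.2 (Nat.le_add_left _ _))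
          fun i _ _ => cutoff_nonneg _ _
    _ = ∑ i ∈ range R, cutoff R ((i : ℤ) + 1) + ∑ i ∈ range n, cutoff R (((R + i : ℕ) : ℤ) + 1) :=
        sum_range_add _ _ _
    _ ≤ ∑ i ∈ range R, (1 : ℝ) +
          ∑ i ∈ range n, (R : ℝ) ^ 2 * (1 / ((R + i : ℕ) : ℝ) - 1 / ((R + (i + 1) : ℕ) : ℝ)) :=
        add_le_add (sum_le_sum fun i _ => min_le_left _ _) (sum_le_sum fun i _ => cutoff_le_tail hR i)
    _ ≤ R + (R : ℝ) ^ 2 * (1 / R) := by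
        rw [← mul_sum]
        gcongr
        · simp
        · exact sum_tail_le hR n
    _ = 2 * R := by field_simp; ring

theorem sum_cutoff_div_le {R : ℕ} (hR : 1 ≤ R) (n : ℕ) :
    ∑ i ∈ range n, cutoff R ((i : ℤ) + 1) / |(((i : ℤ) + 1 : ℤ) : ℝ)| ≤ 2 + Real.log R := by
  have h1 : (0 : ℝ) < R := by exact_mod_cast hR
  have habs : ∀ i : ℕ, |(((i : ℤ) + 1 : ℤ) : ℝ)| = (i : ℝ) + 1 := by
    intro i; push_cast; exact abs_of_pos (by positivity)
  simp_rw [habs]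
  have hharm : ∑ i ∈ range R, 1 / ((i : ℝ) + 1) ≤ 1 + Real.log R := by
    have h := harmonic_le_one_add_log R
    rw [harmonic] at h
    push_cast at h
    simpa [one_div] using h
  calc _ ≤ ∑ i ∈ range (R + n), cutoff R ((i : ℤ) + 1) / ((i : ℝ) + 1) :=
        sum_le_sum_of_subset_of_nonneg (range_subset_range.2 (Nat.le_add_left _ _))
          fun i _ _ => div_nonneg (cutoff_nonneg _ _) (by positivity)
    _ = ∑ i ∈ range R, cutoff R ((i : ℤ) + 1) / ((i : ℝ) + 1) +
          ∑ i ∈ range n, cutoff R (((R + i : ℕ) : ℤ) + 1) / (((R + i : ℕ) : ℝ) + 1) :=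
        sum_range_add _ _ _
    _ ≤ ∑ i ∈ range R, 1 / ((i : ℝ) + 1) +
          ∑ i ∈ range n, R * (1 / ((R + i : ℕ) : ℝ) - 1 / ((R + (i + 1) : ℕ) : ℝ)) := by
        gcongr with i _ i _
        · exact min_le_left _ _
        · have h2 := cutoff_le_tail hR i
          have h3 : (R : ℝ) ≤ ((R + i : ℕ) : ℝ) + 1 := by
            push_cast; linarith [(Nat.cast_nonneg i : (0 : ℝ) ≤ i)]
          calc _ ≤ cutoff R (((R + i : ℕ) : ℤ) + 1) / R :=
                div_le_div_of_nonneg_left (cutoff_nonneg _ _) h1 h3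
            _ ≤ ((R : ℝ) ^ 2 * (1 / ((R + i : ℕ) : ℝ) - 1 / ((R + (i + 1) : ℕ) : ℝ))) / R := by gcongr
            _ = _ := by field_simp
    _ ≤ (1 + Real.log R) + R * (1 / R) := by
        rw [← mul_sum]
        gcongr
        exact sum_tail_le hR n
    _ = 2 + Real.log R := by field_simp; ring

theorem hasSum_int_le_of_even {F : ℤ → ℝ} (he : ∀ n, F (-n) = F n) (h0 : F 0 = 0)
    (hn : ∀ n, 0 ≤ F n) {T : ℝ} (hT : ∀ n, ∑ i ∈ range n, F ((i : ℤ) + 1) ≤ T) :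
    Summable F ∧ ∑' n, F n ≤ 2 * T := by
  have hs := summable_of_sum_range_le (fun i : ℕ => hn ((i : ℤ) + 1)) hT
  have h := hasSum_int_of_even he h0 hs.hasSum
  refine ⟨h.summable, ?_⟩
  rw [h.tsum_eq]
  have := Real.tsum_le_of_sum_range_le (fun i : ℕ => hn ((i : ℤ) + 1)) hT
  linarith

/-- The majorant of the off-diagonal terms, in the coordinates `(b, 2 a + b)`. -/
def majorant (R : ℕ) (q : ℤ × ℤ) : ℝ :=
  2 * (cutoff R q.1 / |(q.1 : ℝ)| * cutoff R q.2 + cutoff R q.1 * (cutoff R q.2 / |(q.2 : ℝ)|))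

theorem majorant_nonneg (R : ℕ) (q : ℤ × ℤ) : 0 ≤ majorant R q := by
  have h1 := cutoff_nonneg R q.1
  have h2 := cutoff_nonneg R q.2
  unfold majorant
  positivity

theorem summable_majorant {R : ℕ} (hR : 1 ≤ R) : Summable (majorant R) ∧
    ∑' q, majorant R q ≤ 32 * (R * (2 + Real.log R)) := by
  obtain ⟨s1, t1⟩ := hasSum_int_le_of_even (F := cutoff R) (cutoff_neg R) (cutoff_zero R)
    (cutoff_nonneg R) (sum_cutoff_le hR)
  obtain ⟨s2, t2⟩ := hasSum_int_le_of_even (F := fun x => cutoff R x / |(x : ℝ)|)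
    (fun n => by rw [cutoff_neg]; simp) (by simp)
    (fun n => div_nonneg (cutoff_nonneg R n) (abs_nonneg _)) (sum_cutoff_div_le hR)
  have n1 : 0 ≤ ∑' x, cutoff R x := tsum_nonneg (cutoff_nonneg R)
  have n2 : 0 ≤ ∑' x : ℤ, cutoff R x / |(x : ℝ)| :=
    tsum_nonneg fun n => div_nonneg (cutoff_nonneg R n) (abs_nonneg _)
  have p1 := s2.mul_of_nonneg s1 (fun n => div_nonneg (cutoff_nonneg R n) (abs_nonneg _))
    (cutoff_nonneg R)
  have p2 := s1.mul_of_nonneg s2 (cutoff_nonneg R)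
    (fun n => div_nonneg (cutoff_nonneg R n) (abs_nonneg _))
  refine ⟨(p1.add p2).mul_left 2, ?_⟩
  have e : ∑' q, majorant R q = 2 * ((∑' x : ℤ, cutoff R x / |(x : ℝ)|) * ∑' x, cutoff R x +
      (∑' x, cutoff R x) * ∑' x : ℤ, cutoff R x / |(x : ℝ)|) := by
    rw [s2.tsum_mul_tsum s1 p1, s1.tsum_mul_tsum s2 p2, ← p1.tsum_add p2, ← tsum_mul_left]
    rfl
  rw [e]
  have hm := mul_le_mul t1 t2 n2 (by positivity)
  nlinarith

/-- A product bound separates the variables `b` and `2 a + b`. From `4 N(λ) = (2 a + b) ^ 2 + 7 b ^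
2` both squares are at most `5 y`; with `M = 2 N + 1` the second-moment bound gives `(5 y) ^ 2 Q ≤
(10 (N + 1)) ^ 2`, whence the condition on `R`. -/
theorem gammaQ_le_cutoff {N R : ℕ} (hR : 10 * (N + 1) ≤ R ^ 2) {p : ℤ × ℤ} (hb : p.2 ≠ 0)
    (hc : 2 * p.1 + p.2 ≠ 0) :
    gammaQ (2 * N + 1) (2 * Real.pi / 7 * nrm p) ≤ cutoff R p.2 * cutoff R (2 * p.1 + p.2) := by
  have hR' : 10 * ((N : ℝ) + 1) ≤ (R : ℝ) ^ 2 := by exact_mod_cast hR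
  set y := 2 * Real.pi / 7 * nrm p with hy
  have hb2 : (0 : ℝ) < (p.2 : ℝ) ^ 2 := by
    have : (p.2 : ℝ) ≠ 0 := by exact_mod_cast hb
    positivity
  have hc2 : (0 : ℝ) < ((2 * p.1 + p.2 : ℤ) : ℝ) ^ 2 := by
    have : ((2 * p.1 + p.2 : ℤ) : ℝ) ≠ 0 := by exact_mod_cast hc
    positivity
  have hN : 4 * (nrm p : ℝ) = ((2 * p.1 + p.2 : ℤ) : ℝ) ^ 2 + 7 * (p.2 : ℝ) ^ 2 := by
    simp only [nrm]; push_cast; ring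
  have hpi := Real.pi_gt_three
  have hy1 : ((2 * p.1 + p.2 : ℤ) : ℝ) ^ 2 ≤ 5 * y := by rw [hy]; nlinarith
  have hy2 : (p.2 : ℝ) ^ 2 ≤ 5 * y := by rw [hy]; nlinarith
  have hy0 : 0 < y := by linarith
  have hq0 := gammaQ_nonneg (2 * N + 1) hy0.le
  have hq1 := gammaQ_le_one (2 * N + 1) hy0.le
  have hq2 := sq_mul_gammaQ_le (2 * N + 1) hy0.le
  push_cast at hq2
  set q := gammaQ (2 * N + 1) y
  set B := (p.2 : ℝ) ^ 2 with hB
  set C := ((2 * p.1 + p.2 : ℤ) : ℝ) ^ 2 with hC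
  have hK : (5 * y) ^ 2 * q ≤ ((R : ℝ) ^ 2) ^ 2 := by
    have : (10 * ((N : ℝ) + 1)) ^ 2 ≤ ((R : ℝ) ^ 2) ^ 2 := by gcongr
    nlinarith
  have hK1 : 5 * y * q ≤ (R : ℝ) ^ 2 := by
    refine abs_le_of_sq_le_sq' ?_ (by positivity) |>.2
    calc (5 * y * q) ^ 2 = ((5 * y) ^ 2 * q) * q := by ring
      _ ≤ ((R : ℝ) ^ 2) ^ 2 * 1 := by gcongr
      _ = _ := mul_one _
  have k1 : q ≤ (R : ℝ) ^ 2 / B := by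
    rw [le_div_iff₀ hb2]; nlinarith
  have k2 : q ≤ (R : ℝ) ^ 2 / C := by
    rw [le_div_iff₀ hc2]; nlinarith
  have k3 : q ≤ (R : ℝ) ^ 2 / B * ((R : ℝ) ^ 2 / C) := by
    rw [div_mul_div_comm, le_div_iff₀ (by positivity)]
    have : B * C ≤ (5 * y) ^ 2 := by rw [sq]; gcongr
    nlinarith
  unfold cutoff
  rw [← hB, ← hC]
  rcases min_choice 1 ((R : ℝ) ^ 2 / B) with h | h <;>
    rcases min_choice 1 ((R : ℝ) ^ 2 / C) with h' | h' <;> rw [h, h'] <;> linarith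

/-- The quotient is `(λ / λ̄) ^ 2`, and `λ ^ 2 - λ̄ ^ 2 = (λ - λ̄) (λ + λ̄)`. -/
theorem norm_lam_pow_four_sub_one {p : ℤ × ℤ} (hp : 0 < nrm p) :
    ‖lam p ^ 4 / (nrm p : ℂ) ^ 2 - 1‖ =
      √7 * |((2 * p.1 + p.2 : ℤ) : ℝ)| * |(p.2 : ℝ)| / nrm p := by
  have hN : (nrm p : ℂ) ≠ 0 := by exact_mod_cast hp.ne'
  have hN' : (0 : ℝ) < nrm p := by exact_mod_cast hp
  have hconj : lam p * (starRingEnd ℂ) (lam p) = nrm p := by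
    rw [Complex.mul_conj, Complex.normSq_eq_norm_sq, norm_lam_sq]; norm_cast
  have hsub := Complex.sub_conj (lam p)
  have hadd := Complex.add_conj (lam p)
  have e : lam p ^ 4 / (nrm p : ℂ) ^ 2 - 1 =
      lam p ^ 2 * (((2 * (lam p).im : ℝ) : ℂ) * I) * ((2 * (lam p).re : ℝ) : ℂ) / (nrm p : ℂ) ^ 2 := by
    rw [← hsub, ← hadd]
    field_simp
    rw [← hconj]
    ring
  rw [e, norm_div, norm_mul, norm_mul, norm_mul, norm_pow, norm_pow, norm_lam_sq, Complex.norm_I,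
    Complex.norm_real, Complex.norm_real, lam_re, lam_im, Complex.norm_intCast, Real.norm_eq_abs,
    Real.norm_eq_abs, abs_of_pos hN']
  rw [show (2 : ℝ) * (√7 * p.2 / 2) = √7 * p.2 by ring, abs_mul, abs_of_nonneg (Real.sqrt_nonneg 7),
    show (2 : ℝ) * ((2 * p.1 + p.2) / 2) = ((2 * p.1 + p.2 : ℤ) : ℝ) by push_cast; ring]
  field_simp

theorem norm_lam_le (p : ℤ × ℤ) :
    ‖lam p‖ ≤ |((2 * p.1 + p.2 : ℤ) : ℝ)| / 2 + √7 * |(p.2 : ℝ)| / 2 := by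
  refine (Complex.norm_le_abs_re_add_abs_im _).trans (le_of_eq ?_)
  rw [lam_re, lam_im, abs_div, abs_div, abs_mul, abs_of_nonneg (Real.sqrt_nonneg 7), abs_two]
  push_cast; rfl

theorem norm_sum_centralTerm_le {N R : ℕ} (hR : 10 * (N + 1) ≤ R ^ 2) {p : ℤ × ℤ} (hb : p.2 ≠ 0) :
    ‖∑ j ∈ range N, centralTerm j p‖ ≤ majorant R (p.2, 2 * p.1 + p.2) := by
  -- Here `λ` is purely imaginary and `w = 1`, so there is no cancellation in `j`; but `√-7` divides
  -- `λ` and `ε = 0`.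
  by_cases hc : 2 * p.1 + p.2 = 0
  · have h0 : eps p = 0 := by rw [eps_eq, hc]; simp
    have : ∀ j, centralTerm j p = 0 := fun j => by rw [centralTerm, h0]; simp
    simp only [this, sum_const_zero, norm_zero]
    exact majorant_nonneg _ _
  have hp : 0 < nrm p := nrm_pos fun h => hb (by rw [h])
  have hN : (nrm p : ℂ) ≠ 0 := by exact_mod_cast hp.ne'
  have hN' : (0 : ℝ) < nrm p := by exact_mod_cast hp
  set w := lam p ^ 4 / (nrm p : ℂ) ^ 2 with hw
  have hwn : ‖w‖ = 1 := by
    rw [hw, norm_div, norm_pow, norm_pow, Complex.norm_intCast, abs_of_pos hN',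
      show ‖lam p‖ ^ 4 = (‖lam p‖ ^ 2) ^ 2 by ring, norm_lam_sq]
    field_simp
  have hB : (0 : ℝ) < |(p.2 : ℝ)| := abs_pos.2 (by exact_mod_cast hb)
  have hC : (0 : ℝ) < |((2 * p.1 + p.2 : ℤ) : ℝ)| := abs_pos.2 (by exact_mod_cast hc)
  have hw1 := norm_lam_pow_four_sub_one hp
  rw [← hw] at hw1
  have h7 : (0 : ℝ) < √7 := by positivity
  have hne : w ≠ 1 := by
    intro h
    rw [h, sub_self, norm_zero] at hw1
    have : 0 < √7 * |((2 * p.1 + p.2 : ℤ) : ℝ)| * |(p.2 : ℝ)| / nrm p := by positivity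
    linarith
  have hy : (0 : ℝ) ≤ 2 * Real.pi / 7 * nrm p := mul_nonneg two_pi_div_seven_pos.le hN'.le
  have hsum : ∑ j ∈ range N, centralTerm j p = (eps p : ℂ) * (lam p / nrm p) *
      ∑ j ∈ range N, w ^ j * (gammaQ (2 * j + 1) (2 * Real.pi / 7 * nrm p) : ℂ) := by
    rw [mul_sum]
    refine sum_congr rfl fun j _ => ?_
    rw [centralTerm, hw, div_pow, ← pow_mul, ← pow_mul, pow_succ, pow_succ (nrm p : ℂ)]
    field_simp
  have hq := norm_sum_pow_mul_le hwn hne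
    (q := fun j => gammaQ (2 * j + 1) (2 * Real.pi / 7 * nrm p))
    (fun a b hab => gammaQ_mono hy (by omega)) (fun j => gammaQ_nonneg _ hy) N
  have hcut := gammaQ_le_cutoff hR hb hc
  rw [hsum, norm_mul, norm_mul, norm_div, Complex.norm_intCast, Complex.norm_intCast (nrm p),
    abs_of_pos hN']
  have heps : |(eps p : ℝ)| ≤ 1 := by rw [eps_eq]; exact abs_legendreSym_seven_le _
  set G := cutoff R p.2 * cutoff R (2 * p.1 + p.2) with hG
  have hG0 : 0 ≤ G := mul_nonneg (cutoff_nonneg _ _) (cutoff_nonneg _ _)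
  have h72 : 2 ≤ √7 := Real.le_sqrt_of_sq_le (by norm_num)
  calc _ ≤ 1 * ((|((2 * p.1 + p.2 : ℤ) : ℝ)| / 2 + √7 * |(p.2 : ℝ)| / 2) / nrm p) *
        (4 / ‖w - 1‖ * G) := by
        gcongr
        · exact norm_lam_le p
        · exact hq.trans (mul_le_mul_of_nonneg_left hcut (by positivity))
    _ = 2 * (1 / √7 * (G / |(p.2 : ℝ)|) + G / |((2 * p.1 + p.2 : ℤ) : ℝ)|) := by
        rw [hw1]; field_simp; ring
    _ ≤ 2 * (1 * (G / |(p.2 : ℝ)|) + G / |((2 * p.1 + p.2 : ℤ) : ℝ)|) := by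
        gcongr
        rw [div_le_one h7]; linarith
    _ = majorant R (p.2, 2 * p.1 + p.2) := by
        rw [majorant, hG]; ring

theorem off_diagonal_bound {N R : ℕ} (hR : 10 * (N + 1) ≤ R ^ 2) (hR1 : 1 ≤ R) :
    ‖∑' p : ({p : ℤ × ℤ | p.2 = 0}ᶜ : Set (ℤ × ℤ)), ∑ j ∈ range N, centralTerm j p‖ ≤
      32 * (R * (2 + Real.log R)) := by
  obtain ⟨hs, ht⟩ := summable_majorant hR1
  have hinj : Function.Injective fun p : ({p : ℤ × ℤ | p.2 = 0}ᶜ : Set (ℤ × ℤ)) =>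
      ((p.1.2, 2 * p.1.1 + p.1.2) : ℤ × ℤ) := by
    rintro ⟨⟨a, b⟩, h⟩ ⟨⟨a', b'⟩, h'⟩ hh
    simp only [Prod.mk.injEq] at hh
    refine Subtype.ext (Prod.ext ?_ ?_) <;> simp <;> omega
  have hs' := hs.comp_injective hinj
  refine (tsum_of_norm_bounded hs'.hasSum fun p => norm_sum_centralTerm_le hR p.2).trans ?_
  exact (Summable.tsum_le_tsum_of_inj _ hinj (fun q _ => majorant_nonneg R q) (fun _ => le_rfl)
    hs' hs).trans ht

/-! ### Assembly of the first moment. -/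

theorem sum_one_div_sqrt_le (N : ℕ) : ∑ j ∈ range N, 1 / √(2 * (j : ℝ) + 1) ≤ 2 * √N := by
  induction N with
  | zero => simp
  | succ n ih =>
    rw [sum_range_succ]
    have hn : (0 : ℝ) ≤ n := Nat.cast_nonneg n
    have a2 : √((n + 1 : ℕ) : ℝ) ^ 2 = n + 1 := by
      rw [Real.sq_sqrt (by positivity)]; push_cast; ring
    have b2 : √(n : ℝ) ^ 2 = n := Real.sq_sqrt hn
    have ha : 0 < √((n + 1 : ℕ) : ℝ) := Real.sqrt_pos.2 (by positivity)
    have hb : 0 ≤ √(n : ℝ) := Real.sqrt_nonneg _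
    have h1 : √((n + 1 : ℕ) : ℝ) ≤ √(2 * (n : ℝ) + 1) := by
      apply Real.sqrt_le_sqrt; push_cast; linarith
    have h2 : 1 / √(2 * (n : ℝ) + 1) ≤ 1 / √((n + 1 : ℕ) : ℝ) := by gcongr
    have h3 : 1 / √((n + 1 : ℕ) : ℝ) ≤ 2 * (√((n + 1 : ℕ) : ℝ) - √(n : ℝ)) := by
      rw [div_le_iff₀ ha]
      nlinarith [sq_nonneg (√((n + 1 : ℕ) : ℝ) - √(n : ℝ))]
    linarith

theorem norm_sum_heckeL_sub_le {N R : ℕ} (hR : 10 * (N + 1) ≤ R ^ 2) (hR1 : 1 ≤ R) :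
    ‖∑ j ∈ range N, heckeL (4 * j + 1) (1 / 2) - N * ((2 * Real.pi / √7 : ℝ) : ℂ)‖ ≤
      48 * √N + 32 * (R * (2 + Real.log R)) := by
  have hs : ∀ j, HasSum (centralTerm j) (heckeL (4 * j + 1) (1 / 2)) := hasSum_central_value
  have hG : HasSum (fun p => ∑ j ∈ range N, centralTerm j p)
      (∑ j ∈ range N, heckeL (4 * j + 1) (1 / 2)) := hasSum_sum fun j _ => hs j
  have hsplit := Summable.tsum_add_tsum_compl (f := fun p => ∑ j ∈ range N, centralTerm j p) (s := {p : ℤ × ℤ | p.2 = 0})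
    (hG.summable.subtype _) (hG.summable.subtype _)
  rw [hG.tsum_eq] at hsplit
  let e : ℤ ≃ ({p : ℤ × ℤ | p.2 = 0} : Set (ℤ × ℤ)) :=
    ⟨fun a => ⟨(a, 0), rfl⟩, fun p => p.1.1, fun a => rfl, fun p => by
      obtain ⟨⟨a, b⟩, h⟩ := p
      have h : b = 0 := h
      subst h; rfl⟩
  have hdiag : ∑' p : ({p : ℤ × ℤ | p.2 = 0} : Set (ℤ × ℤ)), ∑ j ∈ range N, centralTerm j p =
      ∑ j ∈ range N, ∑' a : ℤ, centralTerm j (a, 0) := by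
    rw [← e.tsum_eq]
    refine Summable.tsum_finsetSum fun j _ => ?_
    exact (hs j).summable.comp_injective (i := fun a : ℤ => ((a, 0) : ℤ × ℤ))
      fun a b h => congrArg Prod.fst h
  rw [hdiag] at hsplit
  have hoff := off_diagonal_bound hR hR1
  have hreal : ‖∑ j ∈ range N, ∑' a : ℤ, centralTerm j (a, 0) - N * ((2 * Real.pi / √7 : ℝ) : ℂ)‖ ≤
      48 * √N := by
    have e1 : (N : ℂ) * ((2 * Real.pi / √7 : ℝ) : ℂ) =
        ∑ j ∈ range N, ((2 * Real.pi / √7 : ℝ) : ℂ) := by simp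
    rw [e1, ← sum_sub_distrib]
    calc _ ≤ ∑ j ∈ range N, 24 * (1 / √(2 * (j : ℝ) + 1)) := by
          refine (norm_sum_le _ _).trans (sum_le_sum fun j _ => (real_part_bound j).trans (le_of_eq ?_))
          ring
      _ = 24 * ∑ j ∈ range N, 1 / √(2 * (j : ℝ) + 1) := by rw [mul_sum]
      _ ≤ 24 * (2 * √N) := by gcongr; exact sum_one_div_sqrt_le N
      _ = 48 * √N := by ring
  rw [← hsplit, add_sub_right_comm]
  exact (norm_add_le _ _).trans (add_le_add hreal hoff)

theorem firstMoment_sub_isBigO :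
    (fun N : ℕ => firstMoment N - ((2 * Real.pi / √7 : ℝ) : ℂ)) =O[atTop]
      (fun N : ℕ => Real.log (N : ℝ) / √(N : ℝ)) := by
  -- For `N ≥ 2`: `48 ≤ 96 log N` since `log N ≥ 1 / 2`, and `R ≤ 6 √N`, `2 + log R ≤ 8 log N` in
  -- the off-diagonal bound.
  refine IsBigO.of_bound (96 + 32 * 6 * 8) ?_
  filter_upwards [eventually_ge_atTop 2] with N hN
  have hN2 : (2 : ℝ) ≤ N := by exact_mod_cast hN
  have hN0 : (0 : ℝ) < N := by linarith
  set R := Nat.sqrt (10 * (N + 1)) + 1 with hRdef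
  have hR : 10 * (N + 1) ≤ R ^ 2 := by
    rw [hRdef, sq]; exact (Nat.lt_succ_sqrt _).le
  have hR1 : 1 ≤ R := by omega
  have hs0 : 0 < √(N : ℝ) := Real.sqrt_pos.2 hN0
  have hss : √(N : ℝ) * √(N : ℝ) = N := Real.mul_self_sqrt hN0.le
  have hs1 : 1 ≤ √(N : ℝ) := by rw [Real.one_le_sqrt]; linarith
  have hR6 : (R : ℝ) ≤ 6 * √N := by
    have h1 : (Nat.sqrt (10 * (N + 1)) : ℝ) ^ 2 ≤ 10 * ((N : ℝ) + 1) := by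
      exact_mod_cast Nat.sqrt_le' (10 * (N + 1))
    have h2 : (Nat.sqrt (10 * (N + 1)) : ℝ) ≤ 5 * √N := by
      refine abs_le_of_sq_le_sq' ?_ (by positivity) |>.2
      nlinarith
    rw [hRdef]; push_cast; linarith
  have hlog : 2 + Real.log R ≤ 8 * Real.log N := by
    have hl2 := Real.log_two_gt_d9
    have hlN : Real.log 2 ≤ Real.log N := Real.log_le_log (by norm_num) hN2
    have h1 : Real.log R ≤ Real.log (8 * N) := by
      refine Real.log_le_log (by exact_mod_cast hR1) (hR6.trans ?_)
      nlinarith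
    rw [Real.log_mul (by norm_num) hN0.ne', show (8 : ℝ) = 2 ^ 3 by norm_num, Real.log_pow] at h1
    push_cast at h1
    linarith
  have hlN : 1 / 2 ≤ Real.log N := by
    have hl2 := Real.log_two_gt_d9
    have := Real.log_le_log (by norm_num) hN2
    linarith
  have hmain := norm_sum_heckeL_sub_le hR hR1
  have e1 : firstMoment N - ((2 * Real.pi / √7 : ℝ) : ℂ) = (1 / (N : ℂ)) *
      (∑ j ∈ range N, heckeL (4 * j + 1) (1 / 2) - N * ((2 * Real.pi / √7 : ℝ) : ℂ)) := by
    have hNc : (N : ℂ) ≠ 0 := by exact_mod_cast hN0.ne'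
    have e2 : ∑ n ∈ Icc 1 N, heckeL (4 * n - 3) (1 / 2) = ∑ j ∈ range N, heckeL (4 * j + 1) (1 / 2) := by
      rw [← Finset.Ico_add_one_right_eq_Icc, Finset.sum_Ico_eq_sum_range]
      refine sum_congr (by simp) fun j _ => ?_
      congr 1
      omega
    rw [firstMoment, e2, mul_sub]
    congr 1
    field_simp
  rw [e1, norm_mul, norm_div, norm_one, Complex.norm_natCast,
    Real.norm_of_nonneg (div_nonneg (by linarith) hs0.le)]
  have hfin : 48 * √(N : ℝ) + 32 * (R * (2 + Real.log R)) ≤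
      (96 + 32 * 6 * 8) * (√N * Real.log N) := by
    have h1 : √(N : ℝ) * (1 / 2) ≤ √N * Real.log N := by gcongr
    have h2 : (R : ℝ) * (2 + Real.log R) ≤ 6 * √N * (8 * Real.log N) := by
      refine mul_le_mul hR6 hlog ?_ (by positivity)
      have := Real.log_nonneg (show (1 : ℝ) ≤ R by exact_mod_cast hR1)
      linarith
    linarith
  calc _ ≤ 1 / (N : ℝ) * ((96 + 32 * 6 * 8) * (√N * Real.log N)) := by gcongr; exact hmain.trans hfin
    _ = _ := by
      have h : √(N : ℝ) / N = 1 / √N := Real.sqrt_div_self'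
      calc _ = (96 + 32 * 6 * 8) * Real.log N * (√(N : ℝ) / N) := by ring
        _ = _ := by rw [h]; ring

end HeckeSeven

end

theorem theorem1 :
    (∀ n : ℕ, 1 ≤ n → HeckeSeven.IsHeckeL (4 * n - 3) (HeckeSeven.heckeL (4 * n - 3))) ∧
      (fun N : ℕ => HeckeSeven.firstMoment N - ((2 * Real.pi / √7 : ℝ) : ℂ)) =O[atTop]
        (fun N : ℕ => Real.log (N : ℝ) / √(N : ℝ)) := by
  refine ⟨fun n hn => ?_, HeckeSeven.firstMoment_sub_isBigO⟩
  obtain ⟨j, rfl⟩ : ∃ j, n = j + 1 := ⟨n - 1, by omega⟩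
  have h : 4 * (j + 1) - 3 = 4 * j + 1 := by omega
  rw [h]
  exact HeckeSeven.isHeckeL_heckeL j
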